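/- **Setting.** A geometry $(G,I,O)$ is a finite simple graph $G$ (adjacency $\sim$) with vertex sets $I,O\subseteq V(G)$; write $I^c,O^c$ for the complements. For $M\subseteq O^c$, a *modified flow* for $(G,I,O,M)$ is a pair $(f,\preceq)$ of an injective function $f:O^c\to I^c$ and a partial order $\preceq$ on $V(G)$ such that, for all $v\in O^c$ and $w\in V(G)$: (a) $f(v)\sim v$ if $v\notin M$; (b) $f(v)=v$ or $f(v)\sim v$ if $v\in M$; (c) $v\preceq f(v)$; (d) $w\sim f(v)$ implies $v\preceq w$. One-way procedures are compositions (right to left) of the completely positive maps: $\mathsf N_v$ (prepare the qubit $v$ in the state $|+\rangle$); $\mathsf E_{vw}$ (controlled-$Z$ on $v,w$); $\mathsf M_v^{\theta;\beta}$ (destructive measurement of $v$ in the basis $|\pm_{\theta'}\rangle=\frac1{\sqrt2}(|0\rangle\pm e^{i\theta'}|1\rangle)$ with $\theta'=(-1)^\beta\theta$, storing the result in the bit $\mathsf s[v]$; $\theta$ is its default angle, and $\mathsf M_v^\theta=\mathsf M_v^{\theta;0}$); the corrections $\mathsf X_v^\beta,\mathsf Z_v^\beta$ (apply $X^\beta$,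 $Z^\beta$ to $v$); and the shift $\mathsf S_v^\beta$ (add $\beta$ to $\mathsf s[v]$). Here $\beta$ is a parity of earlier measurement results. Angles are taken modulo $2\pi$. The geometry underlying a procedure consists of the graph of its entangling maps on its qubits, the set $I$ of qubits that it does not prepare and the set $O$ of qubits that it does not measure. A procedure *performs a unitary transformation* if it is well-formed and, measurement results being discarded at the end, its map from operators on the qubits of $I$ to operators on the qubits of $O$ is $\rho\mapsto U\rho U^\dagger$ for a unitary embedding $U$ ($U^\dagger U=1$, and also $UU^\dagger=1$ if $|I|=|O|$). **The constructions.** Both take a unitary circuit over $\{H,T,\mathrm{CZ}\}$, possibly introducing fresh qubits in the state $|+\rangle$; in the simplified RBB construction the circuit must have linear nearest-neighbour topology. 1. Cancel pairs of $\mathrm{CZ}$ gates on a common pair of wires separated only by gates commuting with them. In the RBB construction, replace each remaining $\mathrm{CZ}$ by $\mathrm{Zz}\,(T^\dagger\otimes T^\dagger)^2$, where $\mathrm{Zz}=e^{-i\pi Z\otimes Z/4}$. Commute all powers of $T$ (taking exponents modulo $8$) to just before the next $H$ on the same wire, or to the end of the circuit. 2. With $J(\theta)=He^{-iZ\theta/2}$,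 substitute $HT^m=J(m\pi/4)$, and $T^m=J(0)J(m\pi/4)$ for the powers at the end. In the RBB construction, pad the wires by $J(0)J(0)$ and $J(\frac\pi2)J(\frac\pi2)J(\frac\pi2)$ so that each $\mathrm{Zz}$ acts at equal numbers of preceding $J$ gates on its two wires, and not just one such position after a $\mathrm{Zz}$ on the same two wires. Then write the circuit with tensor indices, where each gate $J(\theta)$ deprecates the current index of its wire and advances a new one, and the other gates leave the indices unchanged. 3. With a qubit for each index, replace: a fresh qubit with index $v$ by $\mathsf N_v$; $J(\theta)$ from the index $v$ to the index $w$ by $\mathsf X_w^{\mathsf s[v]}\mathsf M_v^{-\theta}\mathsf E_{vw}\mathsf N_w$; $\mathrm{CZ}$ on $v,w$ by $\mathsf E_{vw}$; and $\mathrm{Zz}$ on $v,w$ by $\mathsf Z_v^{\mathsf s[a]}\mathsf Z_w^{\mathsf s[a]}\mathsf M_a^{\pi/2}\mathsf E_{av}\mathsf E_{aw}\mathsf N_a$ with a new qubit $a$. 4. Standardize the procedure (commute preparations and entangling maps to the beginning and corrections to the end, absorbing corrections into measurements) and normalize it (apply Pauli simplifications to measurements with angles in $\frac\pi2\mathbb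 Z$, shift signals and remove the shifts); "without normalization", only standardize. **Lemma.** (i) Suppose that $(f,\preceq)$ is a modified flow for $(G,I,O,M)$. Then for any linear order $\le$ on $V(G)$ extending $\preceq$, and any angles $\theta_u$ ($u\in O^c$) with $\theta_u=\frac\pi2$ for every $u\in M$, the procedure $$\Bigg[\prod_{u\in O^c}^{\le}\Big(\prod_{w\sim f(u),\,w\ne u}\mathsf Z_w^{\mathsf s[u]}\Big)\Big(\prod_{v=f(u),\,v\ne u}\mathsf X_v^{\mathsf s[u]}\Big)\mathsf M_u^{\theta_u}\Bigg]\Big(\prod_{uv\in E(G)}\mathsf E_{uv}\Big)\Big(\prod_{v\in I^c}\mathsf N_v\Big),$$ where the factor of the least $u$ is performed first, has output system $O$ and performs a unitary transformation. (ii) For every one-way procedure $\mathfrak P$ arising from the DKP construction or from the simplified RBB construction (after step 3, after standardization, or after normalization), let $(G,I,O)$ be the geometry underlying $\mathfrak P$, and let $M$ be the set of qubits measured with default angle $\frac\pi2$. Then $(G,I,O,M)$ has a modified flow. -/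

import Mathlib

namespace MBQC

/-! ### One-way procedures -/

/-- The elementary operations of the one-way model, on qubits labelled by `V`.
A classical control expression, the parity of the measurement results of a finite set of qubits,
is given by that set. -/
inductive Instr (V : Type*) where
  /-- preparation of `v` in the state `|+⟩` -/
  | prep (v : V)
  /-- entangling map: controlled-`Z` on `u` and `v` -/
  | ent (u v : V)
  /-- destructive measurement of `v` with default angle `θ` and sign-dependency `β` -/
  | meas (v : V) (θ : Real.Angle) (β : Finset V)
  /-- `X` correction on `v`, controlled by the parity of `β` -/
  | xcorr (v : V) (β : Finset V)
  /-- `Z` correction on `v`, controlled by the parity of `β` -/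
  | zcorr (v : V) (β : Finset V)
  /-- shift operation: adds the parity of `β` to the measurement result of `v` -/
  | shift (v : V) (β : Finset V)

/-- A one-way procedure: its input qubits, and its operations in the order of execution
(the first operation of the list is performed first). -/
structure OneWay (V : Type*) where
  input : Finset V
  instrs : List (Instr V)

section Syntactic

variable {V : Type*} [DecidableEq V]

/-- The qubit system present after an operation on the system `S`. -/
def Instr.live (S : Finset V) : Instr V → Finset V
  | .prep v => insert v S
  | .meas v _ _ => S.erase v
  | _ => S

/-- The set of qubits with a defined measurement result after an operation. -/
def Instr.record (D : Finset V) : Instr V → Finset V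
  | .meas v _ _ => insert v D
  | _ => D

/-- An operation makes sense when `S` is the present system and `D` is the set of the qubits
that have been measured already. -/
def Instr.Admissible (S D : Finset V) : Instr V → Prop
  | .prep v => v ∉ S ∧ v ∉ D
  | .ent u v => u ∈ S ∧ v ∈ S ∧ u ≠ v
  | .meas v _ β => v ∈ S ∧ β ⊆ D
  | .xcorr v β => v ∈ S ∧ β ⊆ D
  | .zcorr v β => v ∈ S ∧ β ⊆ D
  | .shift v β => v ∈ D ∧ β ⊆ D ∧ v ∉ β

def AllAdmissible : List (Instr V) → Finset V → Finset V → Prop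
  | [], _, _ => True
  | c :: L, S, D => c.Admissible S D ∧ AllAdmissible L (c.live S) (c.record D)

/-- The system present after a sequence of operations. -/
def liveAfter : List (Instr V) → Finset V → Finset V
  | [], S => S
  | c :: L, S => liveAfter L (c.live S)

def OneWay.WellFormed (P : OneWay V) : Prop := AllAdmissible P.instrs P.input ∅

def OneWay.output (P : OneWay V) : Finset V := liveAfter P.instrs P.input

end Syntactic

/-! ### Semantics: completely positive maps on density operators -/

section Semantics

variable {V : Type*} [DecidableEq V]

/-- Labels of the standard basis states of the system `S`. -/
abbrev Basis (S : Finset V) : Type _ := ↥S → ZMod 2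

/-- The bit of the qubit `v` in a basis label (`0` if `v` is not in the system). -/
def bit {S : Finset V} (x : Basis S) (v : V) : ZMod 2 :=
  if h : v ∈ S then x ⟨v, h⟩ else 0

/-- The parity of the measurement results of `β`, where `s` is the classical register. -/
def parity (s : V → ZMod 2) (β : Finset V) : ZMod 2 := ∑ w ∈ β, s w

noncomputable section

/-- `(-1) ^ a` for a bit `a`. -/
def sign (a : ZMod 2) : ℂ := if a = 0 then 1 else -1

/-- The components of `|+_θ⟩` (for `b = 0`) and `|-_θ⟩` (for `b = 1`):
`(|0⟩ ± e^{iθ} |1⟩) / √2`. -/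
def ketXY (θ : Real.Angle) (b a : ZMod 2) : ℂ :=
  ((Real.sqrt 2 : ℝ) : ℂ)⁻¹ * (if a = 0 then 1 else sign b * (θ.toCircle : ℂ))

/-- `|+⟩_v ⊗ 1_S`, from the system `S` to the system `S ∪ {v}`. -/
def prepOp (v : V) (S : Finset V) : Matrix (Basis (insert v S)) (Basis S) ℂ :=
  fun x y => if ∀ w : ↥S, x ⟨w, Finset.mem_insert_of_mem w.2⟩ = y w
    then ketXY 0 0 (bit x v) else 0

/-- The controlled-`Z` operator on `u` and `v`. -/
def entOp (u v : V) (S : Finset V) : Matrix (Basis S) (Basis S) ℂ :=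
  Matrix.diagonal fun x => sign (bit x u * bit x v)

/-- `⟨+_θ|_v` (for `b = 0`) and `⟨-_θ|_v` (for `b = 1`), from the system `S` to `S \ {v}`. -/
def measOp (v : V) (θ : Real.Angle) (b : ZMod 2) (S : Finset V) :
    Matrix (Basis (S.erase v)) (Basis S) ℂ :=
  fun x y => if ∀ w : ↥(S.erase v), y ⟨w, Finset.mem_of_mem_erase w.2⟩ = x w
    then star (ketXY θ b (bit y v)) else 0

/-- `X_v ^ b`. -/
def xOp (v : V) (b : ZMod 2) (S : Finset V) : Matrix (Basis S) (Basis S) ℂ :=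
  fun x y => if ∀ w : ↥S, x w = y w + (if (w : V) = v then b else 0) then 1 else 0

/-- `Z_v ^ b`. -/
def zOp (v : V) (b : ZMod 2) (S : Finset V) : Matrix (Basis S) (Basis S) ℂ :=
  Matrix.diagonal fun x => sign (b * bit x v)

/-- An operator on the qubits of `S` together with the classical register of the measurement
results: for each value of the register an operator on the qubits. -/
abbrev State (S : Finset V) : Type _ := (V → ZMod 2) → Matrix (Basis S) (Basis S) ℂ

/-- The completely positive map of an elementary operation. -/
def Instr.act (S : Finset V) : (c : Instr V) → State S → State (c.live S)
  | .prep v, σ => fun s => (prepOp v S * σ s * (prepOp v S).conjTranspose :)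
  | .ent u v, σ => fun s => (entOp u v S * σ s * (entOp u v S).conjTranspose :)
  | .meas v θ β, σ => fun s =>
      let K := fun t : V → ZMod 2 => measOp v (if parity t β = 0 then θ else -θ) (s v) S
      (∑ a : ZMod 2, K (Function.update s v a) * σ (Function.update s v a) *
        (K (Function.update s v a)).conjTranspose :)
  | .xcorr v β, σ => fun s =>
      (xOp v (parity s β) S * σ s * (xOp v (parity s β) S).conjTranspose :)
  | .zcorr v β, σ => fun s =>
      (zOp v (parity s β) S * σ s * (zOp v (parity s β) S).conjTranspose :)
  | .shift v β, σ => fun s => σ (Function.update s v (s v + parity s β))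

def runFrom : (L : List (Instr V)) → (S : Finset V) → State S → State (liveAfter L S)
  | [], _, σ => σ
  | c :: L, S, σ => runFrom L (c.live S) (c.act S σ)

/-- The map on operators of the input system performed by a procedure. The register is initially
zero, and the measurement results are discarded at the end. -/
def OneWay.channel [Fintype V] (P : OneWay V) (ρ : Matrix (Basis P.input) (Basis P.input) ℂ) :
    Matrix (Basis P.output) (Basis P.output) ℂ :=
  ∑ s : V → ZMod 2, runFrom P.instrs P.input (fun t => if t = 0 then ρ else 0) s

/-- The procedure is well-formed, and its map is `ρ ↦ U ρ U†` for a unitary embedding `U` of the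
state space of the input system in that of the output system, which is a unitary bijection when
the two systems have equally many qubits. -/
def OneWay.PerformsUnitary [Fintype V] (P : OneWay V) : Prop :=
  P.WellFormed ∧
  ∃ U : Matrix (Basis P.output) (Basis P.input) ℂ,
    U.conjTranspose * U = 1 ∧
    (P.input.card = P.output.card → U * U.conjTranspose = 1) ∧
    ∀ ρ, P.channel ρ = U * ρ * U.conjTranspose

end

end Semantics

/-! ### The geometry underlying a procedure -/

section Geometry

variable {V : Type*} [DecidableEq V]

def OneWay.prepared (P : OneWay V) : Finset V :=
  (P.instrs.filterMap fun c => match c with | .prep v => some v | _ => none).toFinset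

def OneWay.measured (P : OneWay V) : Finset V :=
  (P.instrs.filterMap fun c => match c with | .meas v _ _ => some v | _ => none).toFinset

/-- The qubits of a procedure. -/
def OneWay.qubits (P : OneWay V) : Finset V := P.input ∪ P.prepared

/-- The pairs acted on by the entangling maps, with multiplicity. -/
def OneWay.entPairs (P : OneWay V) : List (Sym2 V) :=
  P.instrs.filterMap fun c => match c with | .ent u v => some s(u, v) | _ => none

/-- The entanglement graph; an even number of entangling maps on a pair is the identity. -/
def OneWay.graph (P : OneWay V) : SimpleGraph ↥P.qubits where
  Adj u v := u ≠ v ∧ Odd (P.entPairs.count s((u : V), (v : V)))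
  symm := ⟨fun u v h => ⟨h.1.symm, by rw [Sym2.eq_swap]; exact h.2⟩⟩
  loopless := ⟨fun _ h => h.1 rfl⟩

/-- The input subsystem: the qubits that are not prepared. -/
def OneWay.geomInput (P : OneWay V) : Finset ↥P.qubits :=
  Finset.univ.filter fun v => (v : V) ∉ P.prepared

/-- The output subsystem: the qubits that are not measured. -/
def OneWay.geomOutput (P : OneWay V) : Finset ↥P.qubits :=
  Finset.univ.filter fun v => (v : V) ∉ P.measured

open Classical in
/-- The qubits with default measurement angle `π / 2`. -/
noncomputable def OneWay.halfPiQubits (P : OneWay V) : Finset ↥P.qubits :=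
  Finset.univ.filter fun v => ∃ β, Instr.meas (v : V) ((Real.pi / 2 : ℝ) : Real.Angle) β ∈ P.instrs

end Geometry

/-! ### Modified flows -/

/-- `(f, r)` is a modified flow for `(G, I, O, M)`. -/
structure IsModifiedFlow {V : Type*} (G : SimpleGraph V) (I O M : Finset V)
    (f : {v : V // v ∉ O} → {v : V // v ∉ I}) (r : V → V → Prop) : Prop where
  measured : ∀ v ∈ M, v ∉ O
  injective : Function.Injective f
  partialOrder : IsPartialOrder V r
  adj : ∀ v : {v : V // v ∉ O}, (v : V) ∉ M → G.Adj (f v) v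
  eq_or_adj : ∀ v : {v : V // v ∉ O}, (v : V) ∈ M → (f v : V) = v ∨ G.Adj (f v) v
  le_succ : ∀ v : {v : V // v ∉ O}, r v (f v)
  le_of_adj : ∀ (v : {v : V // v ∉ O}) (w : V), G.Adj w (f v) → r v w

open Classical in
/-- The operations associated with a vertex `u` outside `O`: measure `u` with angle `θ u`, apply an
`X` correction on `f u` unless `f u = u`, and apply `Z` corrections on the neighbours of `f u` other
than `u`, all controlled by the measurement result of `u`. -/
noncomputable def flowStep {V : Type*} [Fintype V] [LinearOrder V] (G : SimpleGraph V)
    (I O : Finset V) (f : {v : V // v ∉ O} → {v : V // v ∉ I})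
    (θ : {v : V // v ∉ O} → Real.Angle) (u : {v : V // v ∉ O}) : List (Instr V) :=
  [Instr.meas (u : V) (θ u) ∅] ++
  (if (f u : V) = u then [] else [Instr.xcorr (f u : V) {(u : V)}]) ++
  ((Finset.univ.filter fun w : V => G.Adj w (f u) ∧ w ≠ u).sort).map
    fun w => Instr.zcorr w {(u : V)}

open Classical in
/-- The entangling maps of a graph, one for each edge. -/
noncomputable def graphEnt {V : Type*} [Fintype V] [LinearOrder V] (G : SimpleGraph V) :
    List (Instr V) :=
  ((Finset.univ : Finset V).sort).flatMap fun u =>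
    ((Finset.univ.filter fun v : V => u < v ∧ G.Adj u v).sort).map fun v => Instr.ent u v

/-- The procedure of a function `f : Oᶜ → Iᶜ` with angles `θ` and a linear order: prepare `Iᶜ`,
entangle along the edges of `G`, and then measure and correct for the vertices outside `O` in
increasing order. -/
noncomputable def flowProcedure {V : Type*} [Fintype V] [LinearOrder V] (G : SimpleGraph V)
    (I O : Finset V) (f : {v : V // v ∉ O} → {v : V // v ∉ I})
    (θ : {v : V // v ∉ O} → Real.Angle) : OneWay V where
  input := I
  instrs := (Iᶜ.sort).map Instr.prep ++ graphEnt G ++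
    ((Finset.univ : Finset {v : V // v ∉ O}).sort).flatMap (flowStep G I O f θ)

/-! ### Circuits over `{H, T, CZ}` and their normal form

Wires are labelled by natural numbers. Lists of gates are in the order of execution. -/

inductive Gate where
  /-- a fresh qubit in the state `|+⟩` -/
  | fresh (v : ℕ)
  | H (v : ℕ)
  | T (v : ℕ)
  | CZ (v w : ℕ)

structure Circuit where
  input : Finset ℕ
  gates : List Gate

def Gate.wires (A : Finset ℕ) : Gate → Finset ℕ
  | .fresh v => insert v A
  | _ => A

def Gate.Admissible (A : Finset ℕ) : Gate → Prop
  | .fresh v => v ∉ A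
  | .H v => v ∈ A
  | .T v => v ∈ A
  | .CZ v w => v ∈ A ∧ w ∈ A ∧ v ≠ w

def gatesAdmissible : List Gate → Finset ℕ → Prop
  | [], _ => True
  | g :: L, A => g.Admissible A ∧ gatesAdmissible L (g.wires A)

def Circuit.WellFormed (C : Circuit) : Prop := gatesAdmissible C.gates C.input

/-- All wires of the circuit. -/
def Circuit.wires (C : Circuit) : Finset ℕ := C.gates.foldl Gate.wires C.input

/-- Linear nearest-neighbour topology. -/
def Circuit.NearestNeighbour (C : Circuit) : Prop :=
  ∀ v w, Gate.CZ v w ∈ C.gates → w = v + 1 ∨ v = w + 1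

/-- Remove the first `CZ` on the pair `v, w`, if there is one and it is preceded only by gates
which commute with it. -/
def removeCZ (v w : ℕ) : List Gate → Option (List Gate)
  | [] => none
  | .CZ a b :: L => if s(a, b) = s(v, w) then some L else (removeCZ v w L).map (.CZ a b :: ·)
  | .H a :: L => if a = v ∨ a = w then none else (removeCZ v w L).map (.H a :: ·)
  | .T a :: L => (removeCZ v w L).map (.T a :: ·)
  | .fresh a :: L => (removeCZ v w L).map (.fresh a :: ·)

/-- Cancel pairs of `CZ` gates on a common pair of wires which are separated only by gates with
which they commute. -/
def cancelCZ : List Gate → List Gate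
  | [] => []
  | .CZ v w :: L => (removeCZ v w (cancelCZ L)).getD (.CZ v w :: cancelCZ L)
  | g :: L => g :: cancelCZ L

/-- Gates of circuits in normal form: `HT v m` is `H T ^ m` (the power of `T` acts first), and
`Zz` is `exp (-i π Z ⊗ Z / 4)`. -/
inductive NGate where
  | fresh (v : ℕ)
  | HT (v : ℕ) (m : ZMod 8)
  | T (v : ℕ) (m : ZMod 8)
  | CZ (v w : ℕ)
  | Zz (v w : ℕ)

def Gate.toDKP : Gate → List NGate
  | .fresh v => [.fresh v]
  | .H v => [.HT v 0]
  | .T v => [.T v 1]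
  | .CZ v w => [.CZ v w]

/-- Each `CZ` is replaced by `Zz (T† ⊗ T†) ^ 2`. -/
def Gate.toRBB : Gate → List NGate
  | .CZ v w => [.T v (-2), .T w (-2), .Zz v w]
  | g => g.toDKP

/-- Move all powers of `T` towards the end of the circuit, collecting them immediately before the
next Hadamard operation on the same wire, or at the end. `r` holds the powers being moved, and `W`
lists the wires. -/
def collectT (W : List ℕ) : List NGate → (ℕ → ZMod 8) → List NGate
  | [], r => (W.filter fun v => r v ≠ 0).map fun v => .T v (r v)
  | .T v m :: L, r => collectT W L (Function.update r v (r v + m))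
  | .HT v m :: L, r => .HT v (r v + m) :: collectT W L (Function.update r v 0)
  | g :: L, r => g :: collectT W L r

/-- The normal form of a circuit in the DKP construction. -/
def Circuit.normalDKP (C : Circuit) : List NGate :=
  collectT C.wires.sort ((cancelCZ C.gates).flatMap Gate.toDKP) 0

/-- The normal form of a circuit in the simplified RBB construction. -/
def Circuit.normalRBB (C : Circuit) : List NGate :=
  collectT C.wires.sort ((cancelCZ C.gates).flatMap Gate.toRBB) 0

/-! ### Circuits over `{J(θ), CZ, Zz}` and stable-index expressions -/

inductive JGate where
  | fresh (v : ℕ)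
  /-- `J(θ) = H exp (-i Z θ / 2)` -/
  | J (θ : Real.Angle) (v : ℕ)
  | CZ (v w : ℕ)
  | Zz (v w : ℕ)

/-- The angle `m π / 4`. -/
noncomputable def eighth (m : ZMod 8) : Real.Angle := (((m.val : ℝ) * (Real.pi / 4) : ℝ) : Real.Angle)

/-- The substitutions `H T ^ m = J(m π / 4)` and `T ^ m = J(0) J(m π / 4)`. -/
noncomputable def NGate.toJ : NGate → List JGate
  | .fresh v => [.fresh v]
  | .HT v m => [.J (eighth m) v]
  | .T v m => [.J (eighth m) v, .J 0 v]
  | .CZ v w => [.CZ v w]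
  | .Zz v w => [.Zz v w]

/-- `d v` is the position of the current tensor index of the wire `v`. -/
def JGate.advance (d : ℕ → ℕ) : JGate → ℕ → ℕ
  | .J _ v => Function.update d v (d v + 1)
  | _ => d

/-- `J(0) J(0)`, which is the identity. -/
noncomputable def idTwo (v : ℕ) : List JGate := [.J 0 v, .J 0 v]

/-- `J(π/2) J(π/2) J(π/2)`, which is the identity up to a phase. -/
noncomputable def idThree (v : ℕ) : List JGate :=
  List.replicate 3 (.J ((Real.pi / 2 : ℝ) : Real.Angle) v)

/-- The padding that brings the wires `v` and `w`, with current positions `j` and `k`, to a common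
position. -/
noncomputable def syncPad (v w : ℕ) (j k : ℕ) : List JGate :=
  if j = k then []
  else if j < k then
    if k - j = 1 ∨ k - j = 3 then idThree v ++ syncPad v w (j + 3) k
    else idTwo v ++ syncPad v w (j + 2) k
  else
    if j - k = 1 ∨ j - k = 3 then idThree w ++ syncPad v w j (k + 3)
    else idTwo w ++ syncPad v w j (k + 2)
termination_by if j = k + 1 ∨ k = j + 1 then 3 else (j - k) + (k - j)
decreasing_by all_goals (split_ifs <;> omega)

/-- The padding before a gate `Zz` on the wires `v, w`. First, if they have a common position and
there is a two-qubit gate between them at the previous position, both are advanced by two; then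
the positions are made equal. The list `Z` holds the pairs and positions of the previous gates. -/
noncomputable def zzPad (d : ℕ → ℕ) (Z : List (Sym2 ℕ × ℕ)) (v w : ℕ) : List JGate :=
  if d v = d w ∧ d v ≠ 0 ∧ (s(v, w), d v - 1) ∈ Z then
    idTwo v ++ idTwo w ++ syncPad v w (d v + 2) (d w + 2)
  else syncPad v w (d v) (d w)

/-- Insert the padding required by the topological constraints of the simplified RBB
construction. -/
noncomputable def pad : List JGate → (ℕ → ℕ) → List (Sym2 ℕ × ℕ) → List JGate
  | [], _, _ => []
  | .Zz v w :: L, d, Z =>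
      let e := (zzPad d Z v w).foldl JGate.advance d
      zzPad d Z v w ++ .Zz v w :: pad L e ((s(v, w), e v) :: Z)
  | g :: L, d, Z => g :: pad L (g.advance d) Z

/-- Terms of stable-index expressions over the index set `ι`. -/
inductive StableTerm (ι : Type*) where
  /-- `|+⟩`, advancing the index `v` -/
  | plus (v : ι)
  /-- `J(θ)`, advancing the index `w` and deprecating the index `v` -/
  | J (θ : Real.Angle) (w v : ι)
  /-- `CZ` with stable indices `v, w` -/
  | CZ (v w : ι)
  /-- `Zz` with stable indices `v, w` -/
  | Zz (v w : ι)

/-- The transliteration of one gate; the tensor index `(v, j)` is the `j`-th index of the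
wire `v`. -/
def JGate.term (d : ℕ → ℕ) : JGate → StableTerm (ℕ × ℕ)
  | .fresh v => .plus (v, d v)
  | .J θ v => .J θ (v, d v + 1) (v, d v)
  | .CZ v w => .CZ (v, d v) (w, d w)
  | .Zz v w => .Zz (v, d v) (w, d w)

def stableIndex : List JGate → (ℕ → ℕ) → List (StableTerm (ℕ × ℕ))
  | [], _ => []
  | g :: L, d => g.term d :: stableIndex L (g.advance d)

/-- The stable-index expression of a circuit in the DKP construction. -/
noncomputable def Circuit.exprDKP (C : Circuit) : List (StableTerm (ℕ × ℕ)) :=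
  stableIndex (C.normalDKP.flatMap NGate.toJ) 0

/-- The stable-index expression of a circuit in the simplified RBB construction. -/
noncomputable def Circuit.exprRBB (C : Circuit) : List (StableTerm (ℕ × ℕ)) :=
  stableIndex (pad (C.normalRBB.flatMap NGate.toJ) 0 []) 0

/-! ### Translation to one-way procedures -/

/-- The procedure for one term. A qubit `Sum.inl i` stands for the tensor index `i`, and `Sum.inr n`
is the mediating qubit of the `n`-th term, if that term is a gate `Zz`. -/
noncomputable def StableTerm.instrs {ι : Type*} [DecidableEq ι] (n : ℕ) :
    StableTerm ι → List (Instr (ι ⊕ ℕ))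
  | .plus v => [.prep (.inl v)]
  | .J θ w v => [.prep (.inl w), .ent (.inl v) (.inl w), .meas (.inl v) (-θ) ∅,
      .xcorr (.inl w) {.inl v}]
  | .CZ v w => [.ent (.inl v) (.inl w)]
  | .Zz v w => [.prep (.inr n), .ent (.inr n) (.inl w), .ent (.inr n) (.inl v),
      .meas (.inr n) ((Real.pi / 2 : ℝ) : Real.Angle) ∅,
      .zcorr (.inl w) {.inr n}, .zcorr (.inl v) {.inr n}]

/-- The qubit labels of the constructed procedures. -/
abbrev Label : Type := (ℕ × ℕ) ⊕ ℕ

/-- The translation `Φ` of a stable-index expression with the input wires `A`. -/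
noncomputable def translate (A : Finset ℕ) (E : List (StableTerm (ℕ × ℕ))) : OneWay Label where
  input := A.image fun v => .inl (v, 0)
  instrs := E.zipIdx.flatMap fun t => t.1.instrs t.2

/-! ### Standardization and normalization

A rule replaces the consecutive operations on its left by those on its right; lists are in the order
of execution. -/

section Normalization

variable {V : Type*} [DecidableEq V]

def Instr.qubits : Instr V → Finset V
  | .prep v => {v}
  | .ent u v => {u, v}
  | .meas v _ _ => {v}
  | .xcorr v _ => {v}
  | .zcorr v _ => {v}
  | .shift _ _ => ∅

def Instr.IsPrep (c : Instr V) : Prop := ∃ v, c = .prep v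

def Instr.IsEnt (c : Instr V) : Prop := ∃ u v, c = .ent u v

def Instr.IsCorr (c : Instr V) : Prop := ∃ v β, c = .xcorr v β ∨ c = .zcorr v β

/-- Commutation and absorption rules used in standardization. -/
inductive StdRule : List (Instr V) → List (Instr V) → Prop
  | prep (c : Instr V) (v : V) (h : v ∉ c.qubits) : StdRule [c, .prep v] [.prep v, c]
  | ent_meas (u v p : V) (θ : Real.Angle) (β : Finset V) (h : p ∉ ({u, v} : Finset V)) :
      StdRule [.meas p θ β, .ent u v] [.ent u v, .meas p θ β]
  | ent_shift (u v p : V) (β : Finset V) (h : p ∉ ({u, v} : Finset V)) :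
      StdRule [.shift p β, .ent u v] [.ent u v, .shift p β]
  | ent_x_left (u v : V) (β : Finset V) :
      StdRule [.xcorr u β, .ent u v] [.ent u v, .xcorr u β, .zcorr v β]
  | ent_x_right (u v : V) (β : Finset V) :
      StdRule [.xcorr v β, .ent u v] [.ent u v, .xcorr v β, .zcorr u β]
  | ent_x_ne (u v p : V) (β : Finset V) (h : p ∉ ({u, v} : Finset V)) :
      StdRule [.xcorr p β, .ent u v] [.ent u v, .xcorr p β]
  | ent_z (u v p : V) (β : Finset V) : StdRule [.zcorr p β, .ent u v] [.ent u v, .zcorr p β]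
  | ent_ent (u v p q : V) : StdRule [.ent p q, .ent u v] [.ent u v, .ent p q]
  | corr_corr (c c' : Instr V) (h : c.IsCorr) (h' : c'.IsCorr) : StdRule [c, c'] [c', c]
  | x_x (u : V) (β γ : Finset V) : StdRule [.xcorr u β, .xcorr u γ] [.xcorr u (symmDiff β γ)]
  | z_z (u : V) (β γ : Finset V) : StdRule [.zcorr u β, .zcorr u γ] [.zcorr u (symmDiff β γ)]
  | meas_x_ne (u v : V) (θ : Real.Angle) (β γ : Finset V) (h : u ≠ v) :
      StdRule [.xcorr u γ, .meas v θ β] [.meas v θ β, .xcorr u γ]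
  | meas_z_ne (u v : V) (θ : Real.Angle) (β γ : Finset V) (h : u ≠ v) :
      StdRule [.zcorr u γ, .meas v θ β] [.meas v θ β, .zcorr u γ]
  | meas_x (v : V) (θ : Real.Angle) (β γ : Finset V) :
      StdRule [.xcorr v γ, .meas v θ β] [.meas v θ (symmDiff β γ)]
  | meas_z (v : V) (θ : Real.Angle) (β γ : Finset V) :
      StdRule [.zcorr v γ, .meas v θ β] [.meas v θ β, .shift v γ]
  | shift_x (u v : V) (β γ : Finset V) (h : v ∉ γ) :
      StdRule [.xcorr u γ, .shift v β] [.shift v β, .xcorr u γ]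
  | shift_z (u v : V) (β γ : Finset V) (h : v ∉ γ) :
      StdRule [.zcorr u γ, .shift v β] [.shift v β, .zcorr u γ]

/-- Pauli simplifications. -/
inductive PauliRule : List (Instr V) → List (Instr V) → Prop
  | xBasis (v : V) (θ : Real.Angle) (β : Finset V) (h : θ = 0 ∨ θ = (Real.pi : Real.Angle)) :
      PauliRule [.meas v θ β] [.meas v θ ∅]
  | yBasis (v : V) (θ : Real.Angle) (β : Finset V)
      (h : θ = ((Real.pi / 2 : ℝ) : Real.Angle) ∨ θ = ((-(Real.pi / 2) : ℝ) : Real.Angle)) :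
      PauliRule [.meas v θ β] [.meas v θ ∅, .shift v β]

/-- Substitution of `s[v] + β` for `s[v]` in the control expression of an operation. -/
def Instr.subst (v : V) (β : Finset V) : Instr V → Instr V
  | .prep u => .prep u
  | .ent u w => .ent u w
  | .meas u θ γ => .meas u θ (if v ∈ γ then symmDiff γ β else γ)
  | .xcorr u γ => .xcorr u (if v ∈ γ then symmDiff γ β else γ)
  | .zcorr u γ => .zcorr u (if v ∈ γ then symmDiff γ β else γ)
  | .shift u γ => .shift u (if v ∈ γ then symmDiff γ β else γ)

/-- The measurement results changed by an operation. -/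
def Instr.writes : Instr V → Finset V
  | .meas v _ _ => {v}
  | .shift v _ => {v}
  | _ => ∅

/-- Accumulation of shift operations, and signal shifting. -/
inductive ShiftRule : List (Instr V) → List (Instr V) → Prop
  | accum (v : V) (β γ : Finset V) : ShiftRule [.shift v γ, .shift v β] [.shift v (symmDiff β γ)]
  | signal (c : Instr V) (v : V) (β : Finset V) (h : Disjoint c.writes (insert v β)) :
      ShiftRule [.shift v β, c] [c.subst v β, .shift v β]

/-- Apply a rule somewhere in a procedure. -/
inductive Rewrite (R : List (Instr V) → List (Instr V) → Prop) :
    List (Instr V) → List (Instr V) → Prop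
  | mk (l r a b : List (Instr V)) (h : R a b) : Rewrite R (l ++ a ++ r) (l ++ b ++ r)

/-- A step of signal shifting, or the removal of a shift operation at the end. -/
inductive ShiftStep : List (Instr V) → List (Instr V) → Prop
  | rule (a b : List (Instr V)) (h : Rewrite ShiftRule a b) : ShiftStep a b
  | drop (l : List (Instr V)) (v : V) (β : Finset V) : ShiftStep (l ++ [.shift v β]) l

/-- Preparations, then entangling maps, then measurements, each immediately followed by the shift
operations on its result, then corrections. -/
def StandardForm (L : List (Instr V)) : Prop :=
  ∃ (N E : List (Instr V)) (B : List (List (Instr V))) (K : List (Instr V)),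
    L = N ++ E ++ B.flatten ++ K ∧
    (∀ c ∈ N, c.IsPrep) ∧ (∀ c ∈ E, c.IsEnt) ∧
    (∀ b ∈ B, ∃ (v : V) (θ : Real.Angle) (β : Finset V) (γ : List (Finset V)),
      b = .meas v θ β :: γ.map (Instr.shift v)) ∧
    (∀ c ∈ K, c.IsCorr)

/-- No measurement with an angle in `(π / 2) ℤ` has dependencies. -/
def PauliSimplified (L : List (Instr V)) : Prop :=
  ∀ v θ β, Instr.meas v θ β ∈ L →
    (∃ m : ℤ, θ = (((m : ℝ) * (Real.pi / 2) : ℝ) : Real.Angle)) → β = ∅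

/-- Normal form: standard form without shift operations, where measurements with an angle in
`(π / 2) ℤ` have no dependencies. -/
def NormalForm (L : List (Instr V)) : Prop :=
  StandardForm L ∧ (∀ v β, Instr.shift v β ∉ L) ∧ PauliSimplified L

/-- `P` is obtained from `Q` by standardization. -/
def Standardizes (Q P : OneWay V) : Prop :=
  P.input = Q.input ∧ Relation.ReflTransGen (Rewrite StdRule) Q.instrs P.instrs ∧
    StandardForm P.instrs

/-- `P` is a normalization of `Q`: standardize, apply Pauli simplifications, perform signal
shifting, and remove the shift operations. -/
def Normalizes (Q P : OneWay V) : Prop :=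
  P.input = Q.input ∧ ∃ Q₁ : OneWay V, Standardizes Q Q₁ ∧ ∃ L : List (Instr V),
    Relation.ReflTransGen (Rewrite PauliRule) Q₁.instrs L ∧ PauliSimplified L ∧
    Relation.ReflTransGen ShiftStep L P.instrs ∧ NormalForm P.instrs

end Normalization

/-- `P` arises from the translation `Q` of a circuit: it is `Q` itself, or the result of the
construction without normalization, or the result of the complete construction. -/
def ArisesFrom (Q P : OneWay Label) : Prop := P = Q ∨ Standardizes Q P ∨ Normalizes Q P

/-- `P` arises from the DKP construction. -/
def ArisesFromDKP (P : OneWay Label) : Prop :=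
  ∃ C : Circuit, C.WellFormed ∧ ArisesFrom (translate C.input C.exprDKP) P

/-- `P` arises from the simplified RBB construction. -/
def ArisesFromRBB (P : OneWay Label) : Prop :=
  ∃ C : Circuit, C.WellFormed ∧ C.NearestNeighbour ∧
    ArisesFrom (translate C.input C.exprRBB) P

end MBQC

open MBQC

/-! Part (i) is the stabilizer argument for determinism. Once the measurement results are fixed, a
procedure without shifts acts by a single Kraus operator. To avoid matrices between changing
systems, the columns of that operator are regarded as functions of the bits of all qubits (`lift`),
and every operation becomes an explicit linear map on such functions (`lift_kraus`,
`runFrom_branch`). After preparation and entangling, each prepared vertex `p` yields the stabilizer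
consisting of `X` on `p` and `Z` on its neighbours. Conditions (c) and (d) of a flow say that the
stabilizer at `f u` is supported on vertices that are not measured before `u`, so it is still valid
when `u` is measured.

If `f u` is adjacent to `u`, the `Z` factor on `u` exchanges the two results of the measurement,
whatever the angle. If `f u = u`, the angle is π/2 and `X` on `u` exchanges them up to the phase
`i`. What is left of the stabilizer is exactly the correction performed. Hence all branches agree up
to phases, and the channel is a multiple of `ρ ↦ B ρ B†` with one operator `B`; preservation of the
trace makes a rescaling of `B` an isometry (`performsUnitary_of_phases`).

Part (ii) rests on an invariant. The geometry and the set of π/2-measurements depend only on the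
preparations, entangling maps and default angles, up to order (the core), and no rewriting rule
changes these. So it suffices to find a flow for the translation of a list of gates. There `f` takes
an index of a wire to the next one and fixes each mediating qubit, which is measured at π/2. The
order puts `u` before `w` when at some stage of the execution `u` has been measured and `w` has not
(`exists_isModifiedFlow`, `translate_exists_isModifiedFlow`). -/

namespace MBQC

/-! ### Branches: one Kraus operator for each register of results -/

section Branches

variable {V : Type*} [DecidableEq V]

theorem sign_zero : sign 0 = 1 := rfl

theorem zmod_two_cases (a : ZMod 2) : a = 0 ∨ a = 1 := by
  revert a; decide

theorem sign_one : sign 1 = -1 := by simp [sign]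

theorem sign_add (a b : ZMod 2) : sign (a + b) = sign a * sign b := by
  rcases zmod_two_cases a with rfl | rfl <;> rcases zmod_two_cases b with rfl | rfl <;>
    simp [sign_zero, sign_one, show (1 : ZMod 2) + 1 = 0 from rfl]

theorem sign_mul_self (a : ZMod 2) : sign a * sign a = 1 := by
  rcases zmod_two_cases a with rfl | rfl <;> simp [sign_zero, sign_one]

theorem star_sign (a : ZMod 2) : star (sign a) = sign a := by
  rcases zmod_two_cases a with rfl | rfl <;> simp [sign_zero, sign_one]

/-- The set of measured qubits after a sequence of operations. -/
def recordAfter : List (Instr V) → Finset V → Finset V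
  | [], D => D
  | c :: L, D => recordAfter L (c.record D)

/-- Not a shift operation. -/
def Instr.NoShift : Instr V → Prop
  | .shift _ _ => False
  | _ => True

/-- The action of an operation on wave functions of all qubits, for a given register; functions
which do not depend on the bit of a qubit describe systems without this qubit. -/
noncomputable def Instr.lin (s : V → ZMod 2) :
    Instr V → ((V → ZMod 2) → ℂ) → (V → ZMod 2) → ℂ
  | .prep _, Ψ => fun z => ((Real.sqrt 2 : ℝ) : ℂ)⁻¹ * Ψ z
  | .ent u v, Ψ => fun z => sign (z u * z v) * Ψ z
  | .meas v θ β, Ψ => fun z =>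
      ∑ a, star (ketXY (if parity s β = 0 then θ else -θ) (s v) a) * Ψ (Function.update z v a)
  | .xcorr v β, Ψ => fun z => Ψ (z + Pi.single v (parity s β))
  | .zcorr v β, Ψ => fun z => sign (parity s β * z v) * Ψ z
  -- A default value: shifts act on the register only, and the semantic results below exclude them
  -- by `NoShift`.
  | .shift _ _, Ψ => Ψ

noncomputable def linAll (s : V → ZMod 2) :
    List (Instr V) → ((V → ZMod 2) → ℂ) → (V → ZMod 2) → ℂ
  | [], Ψ => Ψ
  | c :: L, Ψ => linAll s L (c.lin s Ψ)

/-- The columns of a matrix, as wave functions of all qubits. -/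
def lift {S : Finset V} {X : Type*} (A : Matrix (Basis S) X ℂ) (y : X) : (V → ZMod 2) → ℂ :=
  fun z => A (fun w => z w) y

/-- The Kraus operator of an operation for a given final register. -/
noncomputable def Instr.kraus (s : V → ZMod 2) (S : Finset V) :
    (c : Instr V) → Matrix (Basis (c.live S)) (Basis S) ℂ
  | .prep v => prepOp v S
  | .ent u v => entOp u v S
  | .meas v θ β => measOp v (if parity s β = 0 then θ else -θ) (s v) S
  | .xcorr v β => xOp v (parity s β) S
  | .zcorr v β => zOp v (parity s β) S
  | .shift _ _ => (1 : Matrix (Basis S) (Basis S) ℂ)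

theorem bit_restrict {S : Finset V} {v : V} (h : v ∈ S) (z : V → ZMod 2) :
    bit (S := S) (fun w => z w) v = z v := by
  simp [bit, h]

theorem lift_prepOp {S : Finset V} {X : Type*} {v : V} (A : Matrix (Basis S) X ℂ) (y : X) :
    lift (prepOp v S * A) y = fun z => ((Real.sqrt 2 : ℝ) : ℂ)⁻¹ * lift A y z := by
  funext z
  simp only [lift, Matrix.mul_apply, prepOp]
  rw [Finset.sum_eq_single (fun w : ↥S => z w)]
  · simp [ketXY, sign_zero]
  · intro b _ hb
    rw [if_neg, zero_mul]
    intro h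
    exact hb (funext fun w => (h w).symm)
  · simp

theorem lift_diagonal {S : Finset V} {X : Type*} (A : Matrix (Basis S) X ℂ) (y : X)
    (d : Basis S → ℂ) :
    lift (Matrix.diagonal d * A) y = fun z => d (fun w => z w) * lift A y z := by
  funext z
  simp only [lift, Matrix.diagonal_mul]

theorem lift_xOp {S : Finset V} {X : Type*} {v : V} (b : ZMod 2)
    (A : Matrix (Basis S) X ℂ) (y : X) :
    lift (xOp v b S * A) y = fun z => lift A y (z + Pi.single v b) := by
  funext z
  simp only [lift, Matrix.mul_apply, xOp]
  rw [Finset.sum_eq_single (fun w : ↥S => (z + Pi.single v b : V → ZMod 2) w)]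
  · rw [if_pos, one_mul]
    intro w
    by_cases h : (w : V) = v
    · simp [h, add_assoc, CharTwo.add_self_eq_zero]
    · simp [h]
  · intro x _ hx
    rw [if_neg, zero_mul]
    intro h
    refine hx (funext fun w => ?_)
    have := h w
    by_cases h' : (w : V) = v
    · simp only [h', if_true] at this
      simp [h', this, add_assoc, CharTwo.add_self_eq_zero]
    · simp [h', this]
  · simp

theorem lift_measOp {S : Finset V} {X : Type*} {v : V} (hv : v ∈ S) (θ : Real.Angle) (b : ZMod 2)
    (A : Matrix (Basis S) X ℂ) (y : X) :
    lift (measOp v θ b S * A) y =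
      fun z => ∑ a, star (ketXY θ b a) * lift A y (Function.update z v a) := by
  funext z
  simp only [lift, Matrix.mul_apply, measOp]
  have hinj : Function.Injective (fun (a : ZMod 2) (w : ↥S) => Function.update z v a w) := by
    intro a a' h
    simpa using congrFun h ⟨v, hv⟩
  -- The row belonging to `z` is supported on the two labels that agree with `z` off `v`.
  rw [← Finset.sum_subset (Finset.subset_univ
    (Finset.univ.image fun (a : ZMod 2) (w : ↥S) => Function.update z v a w))]
  · rw [Finset.sum_image hinj.injOn]
    refine Finset.sum_congr rfl fun a _ => ?_
    rw [if_pos]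
    · simp [bit, hv]
    · intro w
      simp [Function.update_of_ne (Finset.ne_of_mem_erase w.2)]
  · intro x _ hx
    rw [if_neg, zero_mul]
    intro h
    refine hx (Finset.mem_image.2 ⟨x ⟨v, hv⟩, Finset.mem_univ _, funext fun w => ?_⟩)
    by_cases h' : (w : V) = v
    · subst h'; simp
    · rw [Function.update_of_ne h']
      exact (h ⟨w, Finset.mem_erase.2 ⟨h', w.2⟩⟩).symm

/-- Replaces products of matrices whose types change with the system by maps on one fixed function
space. Admissibility ensures that the bits read by the operation belong to the system. -/
theorem lift_kraus {S D : Finset V} {X : Type*} {c : Instr V} (hc : c.Admissible S D)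
    (s : V → ZMod 2) (A : Matrix (Basis S) X ℂ) (y : X) :
    lift (c.kraus s S * A) y = c.lin s (lift A y) := by
  cases c with
  | prep v => exact lift_prepOp A y
  | ent u v =>
    refine (lift_diagonal A y _).trans ?_
    funext z
    simp only [bit_restrict hc.1, bit_restrict hc.2.1, Instr.lin]
  | meas v θ β => exact lift_measOp hc.1 _ _ A y
  | xcorr v β => exact lift_xOp _ A y
  | zcorr v β =>
    refine (lift_diagonal A y _).trans ?_
    funext z
    simp only [bit_restrict hc.1, Instr.lin]
  | shift v β =>
    change lift ((1 : Matrix (Basis S) (Basis S) ℂ) * A) y = _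
    rw [Matrix.one_mul]; rfl

theorem lift_injective {S : Finset V} {X : Type*} {A B : Matrix (Basis S) X ℂ}
    (h : ∀ y, lift A y = lift B y) : A = B := by
  ext x y
  have := congrFun (h y) (bit x)
  have hx : (fun w : ↥S => bit x (w : V)) = x := by
    funext w; simp [bit]
  simpa only [lift, hx] using this

open Classical in
/-- The state with the operator `A s` applied in the branch `s`, when the qubits of `D` have been
measured. -/
noncomputable def branch {S : Finset V} {X : Type*} [Fintype X] (D : Finset V)
    (A : (V → ZMod 2) → Matrix (Basis S) X ℂ) (ρ : Matrix X X ℂ) : State S :=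
  fun s => if ∀ v, v ∉ D → s v = 0 then A s * ρ * (A s).conjTranspose else 0

/-- The operators depend only on the results in `D`. -/
def Local {S : Finset V} {X : Type*} (D : Finset V)
    (A : (V → ZMod 2) → Matrix (Basis S) X ℂ) : Prop :=
  ∀ s t, (∀ v ∈ D, s v = t v) → A s = A t

omit [DecidableEq V] in
theorem parity_congr {s t : V → ZMod 2} {β D : Finset V} (h : ∀ v ∈ D, s v = t v) (hβ : β ⊆ D) :
    parity s β = parity t β :=
  Finset.sum_congr rfl fun w hw => h w (hβ hw)

theorem Local.kraus {S D : Finset V} {X : Type*} {c : Instr V}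
    (hc : c.Admissible S D) {A : (V → ZMod 2) → Matrix (Basis S) X ℂ} (hA : Local D A) :
    Local (c.record D) (fun s => c.kraus s S * A s) := by
  intro s t h
  have hD : ∀ v ∈ D, s v = t v := by
    intro v hv
    apply h
    cases c <;> simp [Instr.record, hv]
  have h1 : c.kraus s S = c.kraus t S := by
    cases c with
    | meas v θ β =>
      simp only [Instr.kraus, parity_congr hD hc.2, h v (Finset.mem_insert_self v D)]; rfl
    | xcorr v β => simp only [Instr.kraus, parity_congr hD hc.2]; rfl
    | zcorr v β => simp only [Instr.kraus, parity_congr hD hc.2]; rfl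
    | prep v => rfl
    | ent u v => rfl
    | shift v β => rfl
  simp only [h1, hA s t hD]

theorem sandwich {l m n : Type*} [Fintype l] [Fintype m] [Fintype n]
    (K : Matrix n m ℂ) (A : Matrix m l ℂ) (ρ : Matrix l l ℂ) :
    K * (A * ρ * A.conjTranspose) * K.conjTranspose =
      K * A * ρ * (K * A).conjTranspose := by
  simp only [Matrix.conjTranspose_mul, Matrix.mul_assoc]

/-- The branch form is preserved by each operation. The only case in which registers mix is a
measurement, which sums over the previous value of `s v`; as `v` has not been measured before, only
the value `0` contributes. -/
theorem act_branch {S D : Finset V} {X : Type*} [Fintype X] {c : Instr V}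
    (hc : c.Admissible S D) (hSD : Disjoint S D) (hn : c.NoShift)
    {A : (V → ZMod 2) → Matrix (Basis S) X ℂ} (hA : Local D A) (ρ : Matrix X X ℂ) :
    c.act S (branch D A ρ) = branch (c.record D) (fun s => c.kraus s S * A s) ρ := by
  classical
  have key : ∀ (n : Type _) [Fintype n] (K : Matrix n (Basis S) ℂ) (s : V → ZMod 2),
      K * branch D A ρ s * K.conjTranspose =
        if ∀ v, v ∉ D → s v = 0 then K * A s * ρ * (K * A s).conjTranspose else 0 := by
    intro n _ K s
    unfold branch
    split_ifs
    · rw [sandwich]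
    · simp
  cases c with
  | prep v => funext s; exact key _ (prepOp v S) s
  | ent u v => funext s; exact key _ (entOp u v S) s
  | xcorr v β => funext s; exact key _ (xOp v (parity s β) S) s
  | zcorr v β => funext s; exact key _ (zOp v (parity s β) S) s
  | shift v β => exact hn.elim
  | meas v θ β =>
    have hv : v ∉ D := Finset.disjoint_left.1 hSD hc.1
    have hvβ : v ∉ β := fun h => hv (hc.2 h)
    funext s
    have hpar : ∀ a, parity (Function.update s v a) β = parity s β := fun a =>
      Finset.sum_congr rfl fun w hw => Function.update_of_ne (ne_of_mem_of_not_mem hw hvβ) _ _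
    have hA0 : A (Function.update s v 0) = A s :=
      hA _ _ fun w hw => Function.update_of_ne (ne_of_mem_of_not_mem hw hv) _ _
    simp only [Instr.act, hpar]
    rw [Finset.sum_eq_single 0]
    · refine (key _ (measOp v (if parity s β = 0 then θ else -θ) (s v) S) _).trans ?_
      simp only [branch, hA0]
      congr 1
      simp only [eq_iff_iff, Instr.record, Finset.mem_insert, not_or]
      constructor
      · rintro h w ⟨hw, hwD⟩
        simpa [Function.update_of_ne hw] using h w hwD
      · intro h w hw
        by_cases hwv : w = v
        · subst hwv; simp
        · rw [Function.update_of_ne hwv]; exact h w ⟨hwv, hw⟩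
    · intro a _ ha
      refine (key _ (measOp v (if parity s β = 0 then θ else -θ) (s v) S) _).trans ?_
      rw [if_neg]
      intro h
      exact ha (by simpa using h v hv)
    · simp

theorem disjoint_step {S D : Finset V} {c : Instr V} (hc : c.Admissible S D)
    (hSD : Disjoint S D) : Disjoint (c.live S) (c.record D) := by
  cases c with
  | prep v =>
    exact Finset.disjoint_insert_left.2 ⟨hc.2, hSD⟩
  | meas v θ β =>
    exact Finset.disjoint_insert_right.2
      ⟨Finset.notMem_erase v S, hSD.mono_left (Finset.erase_subset v S)⟩
  | _ => exact hSD

/-- The operators `B s` are products of Kraus operators. They are kept abstract, because their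
columns, computed by `linAll`, already determine them (`lift_injective`). -/
theorem runFrom_branch {X : Type*} [Fintype X] (L : List (Instr V)) (S D : Finset V)
    (hL : AllAdmissible L S D) (hSD : Disjoint S D) (hn : ∀ c ∈ L, c.NoShift)
    (A : (V → ZMod 2) → Matrix (Basis S) X ℂ) (hA : Local D A) :
    ∃ B : (V → ZMod 2) → Matrix (Basis (liveAfter L S)) X ℂ,
      (∀ ρ, runFrom L S (branch D A ρ) = branch (recordAfter L D) B ρ) ∧
      ∀ s y, lift (B s) y = linAll s L (lift (A s) y) := by
  induction L generalizing S D with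
  | nil => exact ⟨A, fun _ => rfl, fun _ _ => rfl⟩
  | cons c L ih =>
    obtain ⟨B, hB, hB'⟩ := ih (c.live S) (c.record D) hL.2 (disjoint_step hL.1 hSD)
      (fun c' h => hn c' (List.mem_cons_of_mem _ h)) (fun s => c.kraus s S * A s)
      (hA.kraus hL.1)
    refine ⟨B, fun ρ => ?_, fun s y => ?_⟩
    · rw [runFrom, act_branch hL.1 hSD (hn c List.mem_cons_self) hA]
      exact hB ρ
    · refine (hB' s y).trans ?_
      rw [lift_kraus hL.1]; rfl

end Branches

/-! ### Preservation of the trace -/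

section Trace

variable {V : Type*} [DecidableEq V]

theorem trace_sandwich {m n : Type*} [Fintype m] [Fintype n] (K : Matrix n m ℂ)
    (σ : Matrix m m ℂ) :
    (K * σ * K.conjTranspose).trace = (K.conjTranspose * K * σ).trace := by
  rw [Matrix.trace_mul_comm, Matrix.mul_assoc]

theorem norm_ketXY (θ : Real.Angle) (b a : ZMod 2) :
    star (ketXY θ b a) * ketXY θ b a = 1 / 2 := by
  have h2 : ((Real.sqrt 2 : ℝ) : ℂ) * ((Real.sqrt 2 : ℝ) : ℂ) = 2 := by
    rw [← Complex.ofReal_mul, Real.mul_self_sqrt (by norm_num)]; norm_num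
  have h3 : (starRingEnd ℂ) (θ.toCircle : ℂ) * (θ.toCircle : ℂ) = 1 := by
    rw [← Circle.coe_inv_eq_conj, ← Circle.coe_mul, inv_mul_cancel, Circle.coe_one]
  have h4 : (((Real.sqrt 2 : ℝ) : ℂ))⁻¹ * (((Real.sqrt 2 : ℝ) : ℂ))⁻¹ = 1 / 2 := by
    rw [← mul_inv, h2]; norm_num
  have h5 := star_sign b
  have h6 := sign_mul_self b
  simp only [Complex.star_def] at h5
  unfold ketXY
  split_ifs
  · simp [h4]
  · simp only [Complex.star_def, map_mul, map_inv₀, Complex.conj_ofReal, h5]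
    linear_combination (sign b * sign b * ((starRingEnd ℂ) (θ.toCircle : ℂ) *
      (θ.toCircle : ℂ))) * h4 + 1 / 2 * h6 * ((starRingEnd ℂ) (θ.toCircle : ℂ) *
      (θ.toCircle : ℂ)) + 1 / 2 * h3

theorem sum_ketXY (θ : Real.Angle) (a a' : ZMod 2) :
    ∑ b, ketXY θ b a * star (ketXY θ b a') = if a = a' then 1 else 0 := by
  have hs : ∑ b : ZMod 2, sign b = 0 := by
    rw [show (Finset.univ : Finset (ZMod 2)) = {0, 1} from rfl, Finset.sum_pair (by decide)]
    simp [sign_zero, sign_one]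
  split_ifs with h
  · subst h
    have : ∀ b, ketXY θ b a * star (ketXY θ b a) = 1 / 2 := fun b => by
      rw [mul_comm]; exact norm_ketXY θ b a
    simp only [this, Finset.sum_const, Finset.card_univ, ZMod.card]
    norm_num
  · have h5 := star_sign
    simp only [Complex.star_def] at h5
    rcases zmod_two_cases a with rfl | rfl <;> rcases zmod_two_cases a' with rfl | rfl
    · exact absurd rfl h
    · simp only [ketXY, if_true, Complex.star_def, map_mul, h5, if_neg one_ne_zero]
      rw [show (0 : ℂ) = (∑ b : ZMod 2, sign b) * ((((Real.sqrt 2 : ℝ) : ℂ))⁻¹ *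
        ((starRingEnd ℂ) (((Real.sqrt 2 : ℝ) : ℂ))⁻¹ * (starRingEnd ℂ) (θ.toCircle : ℂ))) by
          rw [hs, zero_mul], Finset.sum_mul]
      exact Finset.sum_congr rfl fun b _ => by ring
    · simp only [ketXY, if_true, Complex.star_def, map_mul, if_neg one_ne_zero, map_one]
      rw [show (0 : ℂ) = (∑ b : ZMod 2, sign b) * ((((Real.sqrt 2 : ℝ) : ℂ))⁻¹ *
        ((starRingEnd ℂ) (((Real.sqrt 2 : ℝ) : ℂ))⁻¹ * (θ.toCircle : ℂ))) by
          rw [hs, zero_mul], Finset.sum_mul]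
      exact Finset.sum_congr rfl fun b _ => by ring
    · exact absurd rfl h

theorem prepOp_isometry {v : V} {S : Finset V} (hv : v ∉ S) :
    (prepOp v S).conjTranspose * prepOp v S = 1 := by
  ext a b
  rw [Matrix.mul_apply]
  simp only [Matrix.conjTranspose_apply]
  by_cases hab : a = b
  · subst hab
    -- The two extensions of the label `a` to the new qubit; each contributes `1 / 2` to the
    -- diagonal entry.
    let e : ZMod 2 → Basis (insert v S) := fun c w =>
      if h : (w : V) = v then c else a ⟨w, (Finset.mem_insert.1 w.2).resolve_left h⟩
    have he : ∀ c, bit (e c) v = c := fun c => by simp [bit, e]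
    have hinj : Function.Injective e := fun c c' h => by rw [← he c, h, he]
    rw [← Finset.sum_subset (Finset.subset_univ (Finset.univ.image e))]
    · rw [Finset.sum_image hinj.injOn, Matrix.one_apply_eq]
      have : ∀ c, star (prepOp v S (e c) a) * prepOp v S (e c) a = 1 / 2 := by
        intro c
        rw [prepOp, if_pos]
        · exact norm_ketXY _ _ _
        · intro w
          have : (w : V) ≠ v := fun h => hv (h ▸ w.2)
          simp [e, this]
      simp only [this, Finset.sum_const, Finset.card_univ, ZMod.card]
      norm_num
    · intro x _ hx
      rw [prepOp, if_neg, mul_zero]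
      intro h
      refine hx (Finset.mem_image.2 ⟨bit x v, Finset.mem_univ _, funext fun w => ?_⟩)
      by_cases h' : (w : V) = v
      · obtain ⟨w, hw⟩ := w
        obtain rfl : w = v := h'
        simp [e, bit]
      · simp only [e, dif_neg h']
        exact (h ⟨w, (Finset.mem_insert.1 w.2).resolve_left h'⟩).symm
  · rw [Matrix.one_apply_ne hab]
    refine Finset.sum_eq_zero fun x _ => ?_
    by_contra hne
    have h1 := right_ne_zero_of_mul hne
    have h2 := left_ne_zero_of_mul hne
    simp only [prepOp, ne_eq, ite_eq_right_iff, Classical.not_imp, star_eq_zero] at h1 h2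
    exact hab (funext fun w => (h2.1 w).symm.trans (h1.1 w))

theorem diagonal_isometry {S : Finset V} (d : Basis S → ZMod 2) :
    (Matrix.diagonal fun x => sign (d x)).conjTranspose * (Matrix.diagonal fun x => sign (d x)) =
      1 := by
  rw [Matrix.diagonal_conjTranspose, Matrix.diagonal_mul_diagonal, ← Matrix.diagonal_one]
  congr 1
  funext x
  simp only [Pi.star_apply, star_sign, sign_mul_self]

theorem xOp_isometry (v : V) (b : ZMod 2) (S : Finset V) :
    (xOp v b S).conjTranspose * xOp v b S = 1 := by
  ext y y'
  rw [Matrix.mul_apply]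
  simp only [Matrix.conjTranspose_apply]
  rw [Finset.sum_eq_single (fun w => y w + if (w : V) = v then b else 0)]
  · by_cases h : y = y'
    · subst h; simp [xOp]
    · rw [Matrix.one_apply_ne h]
      simpa [xOp] using Function.ne_iff.1 h
  · intro x _ hx
    have : xOp v b S x y = 0 := if_neg fun h => hx (funext h)
    rw [this, star_zero, zero_mul]
  · simp

theorem measOp_complete {v : V} {S : Finset V} (hv : v ∈ S) (θ : Real.Angle) :
    ∑ b, (measOp v θ b S).conjTranspose * measOp v θ b S = 1 := by
  ext y y'
  rw [Matrix.sum_apply]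
  simp only [Matrix.mul_apply, Matrix.conjTranspose_apply]
  rw [Finset.sum_comm, Finset.sum_eq_single
    (fun w : ↥(S.erase v) => y ⟨w, Finset.mem_of_mem_erase w.2⟩)]
  · by_cases h : ∀ w : ↥(S.erase v), y' ⟨w, Finset.mem_of_mem_erase w.2⟩ =
        y ⟨w, Finset.mem_of_mem_erase w.2⟩
    · simp only [measOp, if_pos h, implies_true, if_true, star_star]
      rw [sum_ketXY, Matrix.one_apply]
      congr 1
      simp only [bit, dif_pos hv, eq_iff_iff]
      refine ⟨fun h' => funext fun w => ?_, fun h' => by rw [h']⟩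
      by_cases hw : (w : V) = v
      · obtain ⟨w, hw'⟩ := w
        cases hw
        exact h'
      · exact (h ⟨w, Finset.mem_erase.2 ⟨hw, w.2⟩⟩).symm
    · simp only [measOp, if_neg h, mul_zero, Finset.sum_const_zero]
      rw [Matrix.one_apply_ne]
      rintro rfl
      exact h fun _ => rfl
  · intro x _ hx
    refine Finset.sum_eq_zero fun b _ => ?_
    have : measOp v θ b S x y = 0 := if_neg fun h => hx (funext fun w => (h w).symm)
    rw [this, star_zero, zero_mul]
  · simp

/-- Apart from measurements, operations act by isometries for each register. A measurement preserves
the trace only in the sum over all registers, where `measOp_complete` applies. -/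
theorem trace_act [Fintype V] {S D : Finset V} {c : Instr V} (hc : c.Admissible S D)
    (hn : c.NoShift) (σ : State S) :
    ∑ s, (c.act S σ s).trace = ∑ s, (σ s).trace := by
  have key : ∀ (n : Type _) [Fintype n] (K : Matrix n (Basis S) ℂ) (s : V → ZMod 2),
      K.conjTranspose * K = 1 → (K * σ s * K.conjTranspose).trace = (σ s).trace := by
    intro n _ K s h
    rw [trace_sandwich, h, Matrix.one_mul]
  cases c with
  | prep v => exact Finset.sum_congr rfl fun s _ => key _ (prepOp v S) s (prepOp_isometry hc.1)
  | ent u v => exact Finset.sum_congr rfl fun s _ => key _ (entOp u v S) s (diagonal_isometry _)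
  | xcorr v β =>
    exact Finset.sum_congr rfl fun s _ => key _ (xOp v (parity s β) S) s (xOp_isometry _ _ _)
  | zcorr v β =>
    exact Finset.sum_congr rfl fun s _ => key _ (zOp v (parity s β) S) s (diagonal_isometry _)
  | shift v β => exact hn.elim
  | meas v θ β =>
    let F : (V → ZMod 2) → ZMod 2 → ℂ := fun t b =>
      (measOp v (if parity t β = 0 then θ else -θ) b S * σ t *
        (measOp v (if parity t β = 0 then θ else -θ) b S).conjTranspose).trace
    have hF : ∀ t, ∑ b, F t b = (σ t).trace := by
      intro t
      simp only [F, trace_sandwich]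
      rw [← Matrix.trace_sum, ← Finset.sum_mul, measOp_complete hc.1, Matrix.one_mul]
    calc ∑ s, ((Instr.meas v θ β).act S σ s).trace
        = ∑ s : V → ZMod 2, ∑ a, F (Function.update s v a) (s v) := by
          refine Finset.sum_congr rfl fun s _ => ?_
          simp only [Instr.act]
          refine (Matrix.trace_sum _ _).trans ?_
          rfl
      _ = ∑ s : V → ZMod 2, ∑ b, F s b := by
          rw [← Fintype.sum_prod_type', ← Fintype.sum_prod_type']
          -- Exchanging the old and the new value of `s v` is an involution. It makes the new result
          -- a free summation variable, independent of the register of `σ`.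
          refine Finset.sum_nbij' (fun p => (Function.update p.1 v p.2, p.1 v))
            (fun p => (Function.update p.1 v p.2, p.1 v)) ?_ ?_ ?_ ?_ ?_ <;> simp
      _ = ∑ s, (σ s).trace := Finset.sum_congr rfl fun s _ => hF s

theorem trace_runFrom [Fintype V] (L : List (Instr V)) (S D : Finset V)
    (hL : AllAdmissible L S D) (hn : ∀ c ∈ L, c.NoShift) (σ : State S) :
    ∑ s, (runFrom L S σ s).trace = ∑ s, (σ s).trace := by
  induction L generalizing S D with
  | nil => rfl
  | cons c L ih =>
    refine (ih (c.live S) (c.record D) hL.2 (fun c' h => hn c' (List.mem_cons_of_mem _ h))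
      (c.act S σ)).trans ?_
    exact trace_act hL.1 (hn c List.mem_cons_self) σ

end Trace

end MBQC

namespace MBQC

/-! ### Sequences of operations -/

section Lists

variable {V : Type*} [DecidableEq V]

theorem liveAfter_append (L L' : List (Instr V)) (S : Finset V) :
    liveAfter (L ++ L') S = liveAfter L' (liveAfter L S) := by
  induction L generalizing S with
  | nil => rfl
  | cons c L ih => exact ih _

theorem allAdmissible_append (L L' : List (Instr V)) (S D : Finset V) :
    AllAdmissible (L ++ L') S D ↔
      AllAdmissible L S D ∧ AllAdmissible L' (liveAfter L S) (recordAfter L D) := by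
  induction L generalizing S D with
  | nil => simp [AllAdmissible, liveAfter, recordAfter]
  | cons c L ih => exact (and_congr_right fun _ => ih _ _).trans and_assoc.symm

theorem linAll_append (s : V → ZMod 2) (L L' : List (Instr V)) (Ψ : (V → ZMod 2) → ℂ) :
    linAll s (L ++ L') Ψ = linAll s L' (linAll s L Ψ) := by
  induction L generalizing Ψ with
  | nil => rfl
  | cons c L ih => exact ih _

theorem lin_smul (s : V → ZMod 2) (c : Instr V) (a : ℂ) (Ψ : (V → ZMod 2) → ℂ) :
    c.lin s (a • Ψ) = a • c.lin s Ψ := by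
  funext z
  cases c <;> simp only [Instr.lin, Pi.smul_apply, smul_eq_mul, Finset.mul_sum]
  case meas => exact Finset.sum_congr rfl fun _ _ => by ring
  all_goals ring

theorem linAll_smul (s : V → ZMod 2) (L : List (Instr V)) (a : ℂ) (Ψ : (V → ZMod 2) → ℂ) :
    linAll s L (a • Ψ) = a • linAll s L Ψ := by
  induction L generalizing Ψ with
  | nil => rfl
  | cons c L ih => simp only [linAll, lin_smul, ih]

theorem linAll_prep (s : V → ZMod 2) (l : List V) (Ψ : (V → ZMod 2) → ℂ) :
    linAll s (l.map Instr.prep) Ψ = ((((Real.sqrt 2 : ℝ) : ℂ))⁻¹ ^ l.length) • Ψ := by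
  induction l generalizing Ψ with
  | nil => simp [linAll]
  | cons v l ih =>
    rw [List.map_cons, linAll, ih]
    funext z
    simp only [Instr.lin, Pi.smul_apply, smul_eq_mul, List.length_cons, pow_succ]
    ring

theorem linAll_ent (s : V → ZMod 2) (l : List (V × V)) (Ψ : (V → ZMod 2) → ℂ) :
    linAll s (l.map fun e => Instr.ent e.1 e.2) Ψ =
      fun z => (l.map fun e => sign (z e.1 * z e.2)).prod * Ψ z := by
  induction l generalizing Ψ with
  | nil => simp [linAll]
  | cons v l ih =>
    rw [List.map_cons, linAll, ih]
    funext z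
    simp only [Instr.lin, List.map_cons, List.prod_cons]
    ring

theorem linAll_zcorr (s : V → ZMod 2) (u : V) (l : List V) (Ψ : (V → ZMod 2) → ℂ) :
    linAll s (l.map fun w => Instr.zcorr w {u}) Ψ =
      fun z => (l.map fun w => sign (s u * z w)).prod * Ψ z := by
  induction l generalizing Ψ with
  | nil => simp [linAll]
  | cons v l ih =>
    rw [List.map_cons, linAll, ih]
    funext z
    simp only [Instr.lin, List.map_cons, List.prod_cons, parity, Finset.sum_singleton]
    ring

theorem prep_sequence (l : List V) (hl : l.Nodup) (S : Finset V) (hS : ∀ v ∈ l, v ∉ S) :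
    AllAdmissible (l.map Instr.prep) S ∅ ∧ liveAfter (l.map Instr.prep) S = S ∪ l.toFinset ∧
      recordAfter (l.map Instr.prep) ∅ = ∅ := by
  induction l generalizing S with
  | nil => simp [AllAdmissible, liveAfter, recordAfter]
  | cons v l ih =>
    rw [List.nodup_cons] at hl
    obtain ⟨h1, h2, h3⟩ := ih hl.2 (insert v S) fun w hw => by
      rw [Finset.mem_insert, not_or]
      exact ⟨fun h => hl.1 (h ▸ hw), hS w (List.mem_cons_of_mem _ hw)⟩
    refine ⟨⟨⟨hS v List.mem_cons_self, Finset.notMem_empty v⟩, h1⟩, h2.trans ?_, h3⟩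
    ext w
    simp only [Finset.mem_union, Finset.mem_insert, List.mem_toFinset, List.mem_cons]
    tauto

/-- Operations other than preparations and measurements. -/
def Instr.Static : Instr V → Prop
  | .prep _ => False
  | .meas _ _ _ => False
  | _ => True

/-- Such operations change neither the system nor the record, so each can be checked against the
initial ones. This serves for the entangling phase and for the corrections after a measurement. -/
theorem static_sequence (L : List (Instr V)) (S D : Finset V) (hL : ∀ c ∈ L, c.Static) :
    (AllAdmissible L S D ↔ ∀ c ∈ L, c.Admissible S D) ∧ liveAfter L S = S ∧
      recordAfter L D = D := by
  induction L with
  | nil => simp [AllAdmissible, liveAfter, recordAfter]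
  | cons c L ih =>
    obtain ⟨h1, h2, h3⟩ := ih fun c' h => hL c' (List.mem_cons_of_mem _ h)
    have hS : c.live S = S ∧ c.record D = D := by
      have := hL c List.mem_cons_self
      cases c <;> simp_all [Instr.Static, Instr.live, Instr.record]
    simp only [AllAdmissible, liveAfter, recordAfter, hS.1, hS.2, h1, h2, h3, List.forall_mem_cons,
      and_self]

end Lists

/-! ### Stabilizers and the correction of measurement results -/

section Stabilizers

variable {V : Type*} [Fintype V] [DecidableEq V]

open Classical in
/-- The wave function `Φ` is stabilized by `X` on `p` and `Z` on the neighbours of `p`. -/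
def Stabilized (G : SimpleGraph V) (p : V) (Φ : (V → ZMod 2) → ℂ) : Prop :=
  ∀ z, (∏ w with G.Adj w p, sign (z w)) * Φ (z + Pi.single p 1) = Φ z

/-- Measurement of a vertex with the result `b`. -/
noncomputable def project (u : V) (θ : Real.Angle) (b : ZMod 2) (Φ : (V → ZMod 2) → ℂ) :
    (V → ZMod 2) → ℂ :=
  fun z => ∑ a, star (ketXY θ b a) * Φ (Function.update z u a)

open Classical in
-- A measurement outside the support of a stabilizer (`p` and its neighbours) commutes with it.
theorem Stabilized.project {G : SimpleGraph V} {p u : V} {Φ : (V → ZMod 2) → ℂ}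
    (h : Stabilized G p Φ) (hp : p ≠ u) (hu : ¬ G.Adj u p) (θ : Real.Angle) (b : ZMod 2) :
    Stabilized G p (MBQC.project u θ b Φ) := by
  intro z
  simp only [MBQC.project, Finset.mul_sum]
  refine Finset.sum_congr rfl fun a _ => ?_
  rw [← h (Function.update z u a)]
  have h1 : Function.update (z + Pi.single p 1) u a =
      Function.update z u a + Pi.single p 1 := by
    funext w
    by_cases hw : w = u
    · subst hw; simp [Ne.symm hp]
    · simp [hw]
  rw [h1, mul_left_comm]
  congr 2
  refine Finset.prod_congr rfl fun w hw => ?_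
  rw [Function.update_of_ne]
  rintro rfl
  exact hu (Finset.mem_filter.1 hw).2

theorem Stabilized.smul {G : SimpleGraph V} {p : V} {Φ : (V → ZMod 2) → ℂ}
    (h : Stabilized G p Φ) (a : ℂ) : Stabilized G p (a • Φ) := by
  intro z
  simp only [Pi.smul_apply, smul_eq_mul]
  rw [mul_left_comm, h z]

theorem ketXY_one (θ : Real.Angle) (a : ZMod 2) : ketXY θ 1 a = sign a * ketXY θ 0 a := by
  rcases zmod_two_cases a with rfl | rfl <;> simp [ketXY, sign_zero, sign_one]

/-- At angle π/2 the basis consists of eigenvectors of `Y`, which `X` exchanges up to a phase. This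
is what permits a vertex to be its own successor. -/
theorem ketXY_halfPi (a : ZMod 2) :
    star (ketXY ((Real.pi / 2 : ℝ) : Real.Angle) 1 a) =
      Complex.I * star (ketXY ((Real.pi / 2 : ℝ) : Real.Angle) 0 (a + 1)) := by
  have h : ((((Real.pi / 2 : ℝ) : Real.Angle).toCircle : Circle) : ℂ) = Complex.I := by
    rw [Real.Angle.toCircle_coe, Circle.coe_exp]
    push_cast
    exact Complex.exp_pi_div_two_mul_I
  rcases zmod_two_cases a with rfl | rfl
  · simp only [ketXY, h, sign_zero, if_true, zero_add, if_neg one_ne_zero]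
    have := Complex.I_mul_I
    simp only [Complex.star_def, map_mul, map_inv₀, Complex.conj_ofReal, mul_one,
      one_mul, Complex.conj_I]
    linear_combination ((((Real.sqrt 2 : ℝ) : ℂ))⁻¹) * this
  · simp only [ketXY, h, sign_one, sign_zero, if_true, if_neg one_ne_zero,
      show (1 : ZMod 2) + 1 = 0 from rfl]
    simp [mul_comm]

open Classical in
/-- Correction of a result `1` for a vertex `u` whose successor `p` is adjacent to it. -/
theorem project_one_of_adj {G : SimpleGraph V} {u p : V} {Φ : (V → ZMod 2) → ℂ}
    (h : Stabilized G p Φ) (hu : G.Adj u p) (θ : Real.Angle) (z : V → ZMod 2) :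
    (∏ w with G.Adj w p ∧ w ≠ u, sign (z w)) * project u θ 1 Φ (z + Pi.single p 1) =
      project u θ 0 Φ z := by
  simp only [project, Finset.mul_sum]
  refine Finset.sum_congr rfl fun a _ => ?_
  have h1 : Function.update (z + Pi.single p 1) u a =
      Function.update z u a + Pi.single p 1 := by
    funext w
    by_cases hw : w = u
    · subst hw; simp [hu.ne]
    · simp [hw]
  -- The factor of the stabilizer at `u` is `sign a`, precisely the quotient of the two bras at `a`.
  -- The remaining factors, at the other neighbours, do not involve the summation variable.
  rw [← h (Function.update z u a), h1, ketXY_one, star_mul', star_sign,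
    ← Finset.mul_prod_erase (Finset.univ.filter fun w => G.Adj w p) _
      (Finset.mem_filter.2 ⟨Finset.mem_univ u, hu⟩), Function.update_self]
  have h2 : (Finset.univ.filter fun w => G.Adj w p).erase u =
      Finset.univ.filter fun w => G.Adj w p ∧ w ≠ u := by
    ext w; simp [and_comm]
  rw [h2, Finset.prod_congr rfl fun w hw =>
    show sign (Function.update z u a w) = sign (z w) by
      rw [Function.update_of_ne (Finset.mem_filter.1 hw).2.2]]
  ring

open Classical in
/-- Correction of a result `1` for a vertex which is its own successor. -/
theorem project_one_of_fixed {G : SimpleGraph V} {u : V} {Φ : (V → ZMod 2) → ℂ}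
    (h : Stabilized G u Φ) (z : V → ZMod 2) :
    (∏ w with G.Adj w u ∧ w ≠ u, sign (z w)) *
        project (u : V) ((Real.pi / 2 : ℝ) : Real.Angle) 1 Φ z =
      Complex.I * project (u : V) ((Real.pi / 2 : ℝ) : Real.Angle) 0 Φ z := by
  simp only [project, Finset.mul_sum]
  -- The `X` factor now acts on the measured bit itself, hence the shift of the summation variable.
  refine Fintype.sum_equiv (Equiv.addRight 1) _ _ fun a => ?_
  have h1 : Function.update z u (a + 1) + Pi.single u 1 = Function.update z u a := by
    funext w
    by_cases hw : w = u
    · subst hw; simp [add_assoc, show (1 : ZMod 2) + 1 = 0 from rfl]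
    · simp [hw]
  rw [Equiv.coe_addRight, ← h (Function.update z u (a + 1)), h1, ketXY_halfPi]
  have h2 : (∏ w with G.Adj w u ∧ w ≠ u, sign (z w)) =
      ∏ w with G.Adj w u, sign (Function.update z u (a + 1) w) := by
    refine Finset.prod_congr ?_ fun w hw => ?_
    · ext w
      simp only [Finset.mem_filter, Finset.mem_univ, true_and, and_iff_left_iff_imp]
      exact fun h => h.ne
    · rw [Function.update_of_ne (Finset.mem_filter.1 hw).2.ne]
  rw [h2]
  ring

end Stabilizers

/-! ### Procedures of modified flows -/

section Flow

variable {V : Type*} [Fintype V] [LinearOrder V]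

open Classical in
/-- The ordered pairs of adjacent vertices. -/
noncomputable def graphPairs (G : SimpleGraph V) : List (V × V) :=
  ((Finset.univ : Finset V).sort).flatMap fun u =>
    ((Finset.univ.filter fun v : V => u < v ∧ G.Adj u v).sort).map fun v => (u, v)

theorem graphEnt_eq (G : SimpleGraph V) :
    graphEnt G = (graphPairs G).map fun e => Instr.ent e.1 e.2 := by
  simp [graphEnt, graphPairs, List.map_flatMap, Function.comp_def]

theorem prod_sort {α : Type*} [LinearOrder α] (l : Finset α) (f : α → ℂ) :
    (l.sort.map f).prod = ∏ w ∈ l, f w := by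
  exact ((l.sort_perm_toList _).map f).prod_eq.trans (Finset.prod_map_toList l f)

open Classical in
theorem prod_graphPairs (G : SimpleGraph V) (F : V × V → ℂ) :
    ((graphPairs G).map F).prod = ∏ u, ∏ v with u < v ∧ G.Adj u v, F (u, v) := by
  rw [graphPairs, List.map_flatMap, List.flatMap_def, List.prod_flatten, List.map_map,
    prod_sort]
  refine Finset.prod_congr rfl fun u _ => ?_
  rw [Function.comp_apply, List.map_map, prod_sort]
  rfl

open Classical in
-- Flipping the bit of `p` affects only the factors of edges at `p`. As each edge is listed once,
-- with its smaller end first, the neighbours of `p` come in two groups, above and below `p`.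
theorem prod_graphPairs_flip (G : SimpleGraph V) (p : V) (z : V → ZMod 2) :
    ((graphPairs G).map fun e =>
        sign ((z + Pi.single p 1 : V → ZMod 2) e.1 * (z + Pi.single p 1 : V → ZMod 2) e.2)).prod =
      ((graphPairs G).map fun e => sign (z e.1 * z e.2)).prod *
        ∏ w with G.Adj w p, sign (z w) := by
  rw [prod_graphPairs, prod_graphPairs]
  have h1 : ∀ u v, u < v → sign ((z + Pi.single p 1 : V → ZMod 2) u *
      (z + Pi.single p 1 : V → ZMod 2) v) =
      sign (z u * z v) * ((if u = p then sign (z v) else 1) * if v = p then sign (z u) else 1) := by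
    intro u v huv
    by_cases hu : u = p
    · subst hu
      simp [huv.ne', add_mul, sign_add]
    · by_cases hv : v = p
      · subst hv
        simp [hu, mul_add, sign_add]
      · simp [hu, hv]
  have h2 : (∏ u, ∏ v with u < v ∧ G.Adj u v, if u = p then sign (z v) else 1) =
      ∏ v with p < v ∧ G.Adj p v, sign (z v) := by
    rw [Finset.prod_eq_single p]
    · simp
    · intro u _ hu
      simp [hu]
    · simp
  have h3 : (∏ u, ∏ v with u < v ∧ G.Adj u v, if v = p then sign (z u) else 1) =
      ∏ u with u < p ∧ G.Adj u p, sign (z u) := by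
    rw [Finset.prod_filter]
    refine Finset.prod_congr rfl fun u _ => ?_
    rw [Finset.prod_filter, Finset.prod_eq_single p]
    · simp
    · intro v _ hv
      simp [hv]
    · simp
  have h4 : (∏ w with G.Adj w p, sign (z w)) =
      (∏ v with p < v ∧ G.Adj p v, sign (z v)) * ∏ u with u < p ∧ G.Adj u p, sign (z u) := by
    simp only [Finset.prod_filter]
    rw [← Finset.prod_mul_distrib]
    refine Finset.prod_congr rfl fun w _ => ?_
    rcases lt_trichotomy w p with h | h | h
    · simp [h, h.not_gt]
    · subst h; simp
    · simp [h, h.not_gt, G.adj_comm]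
  rw [h4, ← h2, ← h3]
  simp only [← Finset.prod_mul_distrib]
  refine Finset.prod_congr rfl fun u _ => Finset.prod_congr rfl fun v hv => ?_
  exact h1 u v (Finset.mem_filter.1 hv).2.1

/-- The hypothesis says that `X` on `p` fixes `Ψ`, as for a qubit prepared in `|+⟩`; conjugation by
the entangling maps adds `Z` on the neighbours. -/
theorem stabilized_graphEnt (G : SimpleGraph V) (s : V → ZMod 2) (p : V)
    (Ψ : (V → ZMod 2) → ℂ) (h : ∀ z, Ψ (z + Pi.single p 1) = Ψ z) :
    Stabilized G p (linAll s (graphEnt G) Ψ) := by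
  classical
  intro z
  rw [graphEnt_eq, linAll_ent]
  simp only
  rw [prod_graphPairs_flip, h]
  have : (∏ w with G.Adj w p, sign (z w)) * (∏ w with G.Adj w p, sign (z w)) = 1 := by
    rw [← Finset.prod_mul_distrib]
    exact Finset.prod_eq_one fun w _ => sign_mul_self _
  linear_combination (((graphPairs G).map fun e => sign (z e.1 * z e.2)).prod * Ψ z) * this

variable {G : SimpleGraph V} {I O M : Finset V} {f : {v : V // v ∉ O} → {v : V // v ∉ I}}
  {r : V → V → Prop} {θ : {v : V // v ∉ O} → Real.Angle}

open Classical in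
theorem linAll_flowStep (u : {v : V // v ∉ O}) (s : V → ZMod 2) (Φ : (V → ZMod 2) → ℂ) :
    linAll s (flowStep G I O f θ u) Φ = fun z =>
      (∏ w with G.Adj w (f u) ∧ w ≠ (u : V), sign (s u * z w)) *
        project (u : V) (θ u) (s u) Φ
          (if (f u : V) = u then z else z + Pi.single (f u : V) (s u)) := by
  rw [flowStep, linAll_append, linAll_append, linAll_zcorr]
  funext z
  rw [prod_sort]
  congr 1
  split_ifs <;> simp [linAll, Instr.lin, project, parity]

theorem linAll_flowStep_zero (u : {v : V // v ∉ O}) (Φ : (V → ZMod 2) → ℂ) :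
    linAll 0 (flowStep G I O f θ u) Φ = project (u : V) (θ u) 0 Φ := by
  rw [linAll_flowStep]
  funext z
  simp [sign_zero]

/-- The phase is `I` for a vertex with result `1` that is its own successor, and `1` otherwise. It
must not depend on `Φ`: all columns of a Kraus operator need a common phase. -/
theorem IsModifiedFlow.linAll_flowStep (hf : IsModifiedFlow G I O M f r)
    (hθ : ∀ u : {v : V // v ∉ O}, (u : V) ∈ M → θ u = ((Real.pi / 2 : ℝ) : Real.Angle))
    (u : {v : V // v ∉ O}) (s : V → ZMod 2) :
    ∃ a : ℂ, ‖a‖ = 1 ∧ ∀ Φ : (V → ZMod 2) → ℂ, Stabilized G (f u) Φ →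
      linAll s (flowStep G I O f θ u) Φ = a • project (u : V) (θ u) 0 Φ := by
  simp only [MBQC.linAll_flowStep]
  rcases zmod_two_cases (s u) with hs | hs
  · refine ⟨1, norm_one, fun Φ _ => ?_⟩
    funext z
    simp [hs, sign_zero]
  · simp only [hs, one_mul]
    by_cases hu : (f u : V) = u
    · have hM : (u : V) ∈ M := by
        by_contra hM
        exact (hf.adj u hM).ne hu
      refine ⟨Complex.I, Complex.norm_I, fun Φ h => ?_⟩
      funext z
      rw [if_pos hu, hθ u hM]
      rw [hu] at h ⊢
      exact project_one_of_fixed h z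
    · have hadj : G.Adj (f u) u := by
        by_cases hM : (u : V) ∈ M
        · exact (hf.eq_or_adj u hM).resolve_left hu
        · exact hf.adj u hM
      refine ⟨1, norm_one, fun Φ h => ?_⟩
      funext z
      rw [if_neg hu, one_smul]
      exact project_one_of_adj h hadj.symm (θ u) z

/-- Induction over the measurements. If `u < v`, then `f v` and all its neighbours are at least `v`,
so measuring `u` does not disturb the stabilizer needed for `v`. -/
theorem IsModifiedFlow.linAll_flowSteps (hf : IsModifiedFlow G I O M f r)
    (hr : ∀ u v : V, r u v → u ≤ v)
    (hθ : ∀ u : {v : V // v ∉ O}, (u : V) ∈ M → θ u = ((Real.pi / 2 : ℝ) : Real.Angle))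
    (l : List {v : V // v ∉ O}) (hl : l.Pairwise (· < ·)) (s : V → ZMod 2) :
    ∃ a : ℂ, ‖a‖ = 1 ∧ ∀ Φ : (V → ZMod 2) → ℂ, (∀ u ∈ l, Stabilized G (f u) Φ) →
      linAll s (l.flatMap (flowStep G I O f θ)) Φ =
        a • linAll 0 (l.flatMap (flowStep G I O f θ)) Φ := by
  induction l with
  | nil => exact ⟨1, norm_one, fun _ _ => (one_smul _ _).symm⟩
  | cons u l ih =>
    rw [List.pairwise_cons] at hl
    obtain ⟨a, ha, ha'⟩ := hf.linAll_flowStep hθ u s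
    obtain ⟨b, hb, hb'⟩ := ih hl.2
    refine ⟨a * b, by rw [norm_mul, ha, hb, one_mul], fun Φ h => ?_⟩
    have h' : ∀ v ∈ l, Stabilized G (f v) (project (u : V) (θ u) 0 Φ) := fun v hv => by
      have huv : (u : V) < v := hl.1 v hv
      refine (h v (List.mem_cons_of_mem _ hv)).project ?_ ?_ _ _
      · exact (huv.trans_le (hr _ _ (hf.le_succ v))).ne'
      · exact fun h' => huv.not_ge (hr _ _ (hf.le_of_adj v _ h'))
    rw [List.flatMap_cons, linAll_append, linAll_append, ha' Φ (h u List.mem_cons_self),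
      linAll_flowStep_zero, linAll_smul, hb' _ h', mul_smul]

theorem flowStep_noShift (u : {v : V // v ∉ O}) : ∀ c ∈ flowStep G I O f θ u, c.NoShift := by
  intro c hc
  simp only [flowStep, List.mem_append, List.mem_singleton, List.mem_map] at hc
  rcases hc with (rfl | hc) | ⟨w, _, rfl⟩
  · trivial
  · split_ifs at hc
    · simp at hc
    · rw [List.mem_singleton.1 hc]; trivial
  · trivial

theorem flowProcedure_noShift : ∀ c ∈ (flowProcedure G I O f θ).instrs, c.NoShift := by
  intro c hc
  simp only [flowProcedure, graphEnt_eq, List.mem_append, List.mem_map, List.mem_flatMap] at hc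
  rcases hc with (⟨_, _, rfl⟩ | ⟨_, _, rfl⟩) | ⟨u, _, hu⟩
  · trivial
  · trivial
  · exact flowStep_noShift u c hu

/-- By (c) and (d) the corrections act on vertices after `u`, which are all still present. -/
theorem IsModifiedFlow.flowStep_admissible (hf : IsModifiedFlow G I O M f r)
    (hr : ∀ u v : V, r u v → u ≤ v) (u : {v : V // v ∉ O}) (S D : Finset V)
    (hS : ∀ w : V, (u : V) ≤ w → w ∈ S) :
    AllAdmissible (flowStep G I O f θ u) S D ∧
      liveAfter (flowStep G I O f θ u) S = S.erase u ∧
      recordAfter (flowStep G I O f θ u) D = insert (u : V) D := by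
  classical
  let L : List (Instr V) := (if (f u : V) = u then [] else [Instr.xcorr (f u : V) {(u : V)}]) ++
    ((Finset.univ.filter fun w : V => G.Adj w (f u) ∧ w ≠ u).sort).map
      fun w => Instr.zcorr w {(u : V)}
  have hL : flowStep G I O f θ u = Instr.meas (u : V) (θ u) ∅ :: L := rfl
  have hmem : ∀ c ∈ L, (f u : V) ≠ u ∧ c = Instr.xcorr (f u : V) {(u : V)} ∨
      ∃ w, (G.Adj w (f u) ∧ w ≠ u) ∧ c = Instr.zcorr w {(u : V)} := by
    intro c hc
    simp only [L, List.mem_append, List.mem_map, Finset.mem_sort, Finset.mem_filter,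
      Finset.mem_univ, true_and] at hc
    rcases hc with hc | ⟨w, hw, rfl⟩
    · split_ifs at hc with h
      · simp at hc
      · exact .inl ⟨h, List.mem_singleton.1 hc⟩
    · exact .inr ⟨w, hw, rfl⟩
  obtain ⟨h1, h2, h3⟩ := static_sequence L (S.erase (u : V)) (insert (u : V) D) fun c hc => by
    rcases hmem c hc with ⟨_, rfl⟩ | ⟨w, _, rfl⟩ <;> trivial
  rw [hL]
  refine ⟨⟨⟨hS u le_rfl, Finset.empty_subset _⟩, h1.2 fun c hc => ?_⟩, h2, h3⟩
  have hD : ({(u : V)} : Finset V) ⊆ insert (u : V) D := by simp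
  rcases hmem c hc with ⟨h, rfl⟩ | ⟨w, ⟨hw, hwu⟩, rfl⟩
  · exact ⟨Finset.mem_erase.2 ⟨h, hS _ (hr _ _ (hf.le_succ u))⟩, hD⟩
  · exact ⟨Finset.mem_erase.2 ⟨hwu, hS _ (hr _ _ (hf.le_of_adj u w hw))⟩, hD⟩

theorem IsModifiedFlow.flowSteps_admissible (hf : IsModifiedFlow G I O M f r)
    (hr : ∀ u v : V, r u v → u ≤ v) (l : List {v : V // v ∉ O}) (hl : l.Pairwise (· < ·))
    (S D : Finset V) (hS : ∀ u ∈ l, ∀ w : V, (u : V) ≤ w → w ∈ S) :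
    AllAdmissible (l.flatMap (flowStep G I O f θ)) S D ∧
      liveAfter (l.flatMap (flowStep G I O f θ)) S = S \ (l.map Subtype.val).toFinset := by
  induction l generalizing S D with
  | nil => simp [AllAdmissible, liveAfter]
  | cons u l ih =>
    rw [List.pairwise_cons] at hl
    obtain ⟨h1, h2, h3⟩ := hf.flowStep_admissible (θ := θ) hr u S D (hS u List.mem_cons_self)
    obtain ⟨h4, h5⟩ := ih hl.2 (S.erase u) (insert (u : V) D) fun v hv w hw =>
      Finset.mem_erase.2 ⟨((show (u : V) < v from hl.1 v hv).trans_le hw).ne',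
        hS v (List.mem_cons_of_mem _ hv) w hw⟩
    rw [List.flatMap_cons, allAdmissible_append, liveAfter_append, h2, h3, h5]
    refine ⟨⟨h1, h4⟩, ?_⟩
    ext w
    simp only [Finset.mem_sdiff, Finset.mem_erase, List.mem_toFinset, List.map_cons,
      List.mem_cons]
    tauto

theorem IsModifiedFlow.flowProcedure_wellFormed (hf : IsModifiedFlow G I O M f r)
    (hr : ∀ u v : V, r u v → u ≤ v) :
    (flowProcedure G I O f θ).WellFormed ∧ (flowProcedure G I O f θ).output = O := by
  classical
  obtain ⟨h1, h2, h3⟩ := prep_sequence (Iᶜ.sort) (Finset.sort_nodup _ _) I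
    (fun v hv => Finset.mem_compl.1 ((Finset.mem_sort _).1 hv))
  have h2' : liveAfter ((Iᶜ.sort).map Instr.prep) I = Finset.univ := by
    rw [h2, Finset.sort_toFinset, Finset.union_compl]
  obtain ⟨h4, h5, h6⟩ := static_sequence (graphEnt G) Finset.univ ∅ fun c hc => by
    rw [graphEnt_eq, List.mem_map] at hc
    obtain ⟨_, _, rfl⟩ := hc
    trivial
  have h7 := fun D => hf.flowSteps_admissible (θ := θ) hr
    ((Finset.univ : Finset {v : V // v ∉ O}).sort) (Finset.sortedLT_sort _).pairwise
    Finset.univ D fun _ _ w _ => Finset.mem_univ w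
  constructor
  · change AllAdmissible (_ ++ _ ++ _) I ∅
    rw [allAdmissible_append, allAdmissible_append, liveAfter_append, h2', h5]
    refine ⟨⟨h1, ?_⟩, ?_⟩
    · rw [h3]
      refine h4.2 fun c hc => ?_
      simp only [graphEnt, List.mem_flatMap, List.mem_map, Finset.mem_sort, Finset.mem_filter] at hc
      obtain ⟨u, _, v, hv, rfl⟩ := hc
      exact ⟨Finset.mem_univ _, Finset.mem_univ _, hv.2.1.ne⟩
    · exact (h7 _).1
  · change liveAfter (_ ++ _ ++ _) I = O
    rw [liveAfter_append, liveAfter_append, h2', h5, (h7 ∅).2]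
    ext w
    simp

/-- The condition on `Ψ` describes the wave functions coming from the input system. It provides
stabilizers at all successors, since `f` takes values outside `I`. -/
theorem IsModifiedFlow.linAll_flowProcedure (hf : IsModifiedFlow G I O M f r)
    (hr : ∀ u v : V, r u v → u ≤ v)
    (hθ : ∀ u : {v : V // v ∉ O}, (u : V) ∈ M → θ u = ((Real.pi / 2 : ℝ) : Real.Angle))
    (s : V → ZMod 2) :
    ∃ a : ℂ, ‖a‖ = 1 ∧ ∀ Ψ : (V → ZMod 2) → ℂ,
      (∀ p, p ∉ I → ∀ z, Ψ (z + Pi.single p 1) = Ψ z) →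
      linAll s (flowProcedure G I O f θ).instrs Ψ =
        a • linAll 0 (flowProcedure G I O f θ).instrs Ψ := by
  obtain ⟨a, ha, h⟩ := hf.linAll_flowSteps hr hθ ((Finset.univ : Finset {v : V // v ∉ O}).sort)
    (Finset.sortedLT_sort _).pairwise s
  refine ⟨a, ha, fun Ψ hΨ => ?_⟩
  simp only [flowProcedure, linAll_append, linAll_prep]
  have hE : linAll s (graphEnt G) = linAll 0 (graphEnt G) := by
    funext Φ
    rw [graphEnt_eq, linAll_ent, linAll_ent]
  rw [hE, h]
  intro u _
  refine stabilized_graphEnt G 0 _ _ fun z => ?_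
  simp only [Pi.smul_apply, hΨ _ (f u).2]

/-- Phases cancel in `B ρ B†`; `N` counts the registers that vanish off `D`. -/
theorem sum_branch {S : Finset V} {X : Type*} [Fintype X] (D : Finset V)
    {B : (V → ZMod 2) → Matrix (Basis S) X ℂ} (h : ∀ s, ∃ a : ℂ, ‖a‖ = 1 ∧ B s = a • B 0) :
    ∃ N : ℕ, ∀ ρ, ∑ s, branch D B ρ s = (N : ℂ) • (B 0 * ρ * (B 0).conjTranspose) := by
  classical
  have hsame : ∀ s (ρ : Matrix X X ℂ), B s * ρ * (B s).conjTranspose = B 0 * ρ * (B 0).conjTranspose := by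
    intro s ρ
    obtain ⟨a, ha, h⟩ := h s
    have ha' : star a * a = 1 := by
      rw [Complex.star_def, Complex.conj_mul', ha]; norm_num
    rw [h, Matrix.conjTranspose_smul, Matrix.mul_smul, Matrix.smul_mul, Matrix.smul_mul,
      smul_smul, ha', one_smul]
  refine ⟨(Finset.univ.filter fun s : V → ZMod 2 => ∀ v, v ∉ D → s v = 0).card, fun ρ => ?_⟩
  simp only [branch, hsame]
  rw [Finset.sum_ite, Finset.sum_const_zero, add_zero, Finset.sum_const, Nat.cast_smul_eq_nsmul]

/-- A trace-preserving map with a single Kraus operator, up to a factor, is a conjugation by an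
isometry. -/
theorem exists_isometry {m n : Type*} [Fintype m] [Fintype n] [DecidableEq m] [DecidableEq n]
    {Λ : Matrix n n ℂ → Matrix m m ℂ} (B : Matrix m n ℂ) (N : ℕ)
    (hΛ : ∀ ρ, Λ ρ = (N : ℂ) • (B * ρ * B.conjTranspose)) (htr : ∀ ρ, (Λ ρ).trace = ρ.trace) :
    ∃ U : Matrix m n ℂ, U.conjTranspose * U = 1 ∧
      (Fintype.card m = Fintype.card n → U * U.conjTranspose = 1) ∧
      ∀ ρ, Λ ρ = U * ρ * U.conjTranspose := by
  have hiso : (N : ℂ) • (B.conjTranspose * B) = 1 := by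
    -- Since the trace pairing is nondegenerate, preservation of the trace for all `ρ` determines
    -- `B† B`.
    refine Matrix.ext_iff_trace_mul_right.2 fun ρ => ?_
    rw [Matrix.one_mul, ← htr ρ, hΛ, Matrix.smul_mul, Matrix.trace_smul, Matrix.trace_smul,
      trace_sandwich]
  have hN : ((Real.sqrt N : ℝ) : ℂ) * ((Real.sqrt N : ℝ) : ℂ) = N := by
    rw [← Complex.ofReal_mul, Real.mul_self_sqrt (Nat.cast_nonneg N), Complex.ofReal_natCast]
  have hstar : star ((Real.sqrt N : ℝ) : ℂ) = ((Real.sqrt N : ℝ) : ℂ) := Complex.conj_ofReal _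
  have hU : (((Real.sqrt N : ℝ) : ℂ) • B).conjTranspose * (((Real.sqrt N : ℝ) : ℂ) • B) = 1 := by
    rw [Matrix.conjTranspose_smul, Matrix.mul_smul, Matrix.smul_mul, smul_smul, hstar, hN, hiso]
  refine ⟨((Real.sqrt N : ℝ) : ℂ) • B, hU, fun hcard => ?_, fun ρ => ?_⟩
  · exact (Matrix.mul_eq_one_comm_of_equiv (Fintype.card_eq.1 hcard).some).2 hU
  · rw [hΛ, Matrix.conjTranspose_smul, Matrix.mul_smul, Matrix.smul_mul, Matrix.smul_mul,
      smul_smul, hstar, hN]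

/-- A procedure whose branches agree up to phases performs a unitary transformation. -/
theorem performsUnitary_of_phases {P : OneWay V} (hw : P.WellFormed)
    (hn : ∀ c ∈ P.instrs, c.NoShift)
    (h : ∀ s, ∃ a : ℂ, ‖a‖ = 1 ∧ ∀ Ψ : (V → ZMod 2) → ℂ,
      (∀ p, p ∉ P.input → ∀ z, Ψ (z + Pi.single p 1) = Ψ z) →
      linAll s P.instrs Ψ = a • linAll 0 P.instrs Ψ) :
    P.PerformsUnitary := by
  classical
  refine ⟨hw, ?_⟩
  obtain ⟨B, hB, hB'⟩ := runFrom_branch P.instrs P.input ∅ hw (Finset.disjoint_empty_right _)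
    hn (fun _ => (1 : Matrix (Basis P.input) (Basis P.input) ℂ)) (fun _ _ _ => rfl)
  have hphase : ∀ s, ∃ a : ℂ, ‖a‖ = 1 ∧ B s = a • B 0 := by
    intro s
    obtain ⟨a, ha, h⟩ := h s
    refine ⟨a, ha, lift_injective fun y => ?_⟩
    have : lift (a • B 0) y = a • lift (B 0) y := rfl
    rw [this, hB', hB', h]
    intro p hp z
    have : (fun w : ↥P.input => (z + Pi.single p 1 : V → ZMod 2) w) = fun w : ↥P.input => z w := by
      funext w
      have : (w : V) ≠ p := fun h => hp (h ▸ w.2)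
      simp [this]
    exact congrArg (fun x => (1 : Matrix (Basis P.input) (Basis P.input) ℂ) x y) this
  -- The initial state has branch form, with nothing measured and the identity as operator.
  have hinit : ∀ ρ : Matrix (Basis P.input) (Basis P.input) ℂ,
      (fun t : V → ZMod 2 => if t = 0 then ρ else 0) =
        branch ∅ (fun _ => (1 : Matrix (Basis P.input) (Basis P.input) ℂ)) ρ := by
    intro ρ
    funext t
    simp only [branch, Finset.notMem_empty, not_false_eq_true, forall_true_left,
      Matrix.conjTranspose_one, Matrix.one_mul, Matrix.mul_one]
    congr 1
    exact propext ⟨fun h v => congrFun h v, fun h => funext h⟩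
  obtain ⟨N, hN⟩ := sum_branch (recordAfter P.instrs ∅) hphase
  have hch : ∀ ρ, P.channel ρ = ∑ s, branch (recordAfter P.instrs ∅) B ρ s := by
    intro ρ
    unfold OneWay.channel
    rw [hinit ρ, hB]
    rfl
  have htr : ∀ ρ, (P.channel ρ).trace = ρ.trace := by
    intro ρ
    unfold OneWay.channel
    refine (Matrix.trace_sum _ _).trans ((trace_runFrom P.instrs P.input ∅ hw hn _).trans ?_)
    rw [Finset.sum_eq_single 0] <;> simp +contextual
  obtain ⟨U, h1, h2, h3⟩ := exists_isometry (Λ := P.channel) (B 0) N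
    (fun ρ => (hch ρ).trans (hN ρ)) htr
  exact ⟨U, h1, fun hcard => h2 (by simp [hcard]), h3⟩

end Flow

end MBQC

namespace MBQC

/-! ### The geometry as an invariant of rewriting -/

section Core

variable {V : Type*} [DecidableEq V]

/-- Preparations, entangling maps and measurements, without their control expressions. -/
def Instr.core : Instr V → Option (Instr V)
  | .prep v => some (.prep v)
  | .ent u v => some (.ent u v)
  | .meas v θ _ => some (.meas v θ ∅)
  | _ => none

/-- The pair of qubits of an entangling map. -/
def Instr.pair : Instr V → Option (Sym2 V)
  | .ent u v => some s(u, v)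
  | _ => none

omit [DecidableEq V] in
theorem entPairs_eq (P : OneWay V) :
    P.entPairs = (P.instrs.filterMap Instr.core).filterMap Instr.pair := by
  rw [List.filterMap_filterMap]
  unfold OneWay.entPairs
  congr 1
  funext c
  cases c <;> rfl

theorem mem_prepared {P : OneWay V} {v : V} :
    v ∈ P.prepared ↔ Instr.prep v ∈ P.instrs.filterMap Instr.core := by
  simp only [OneWay.prepared, List.mem_toFinset, List.mem_filterMap]
  refine exists_congr fun c => and_congr_right fun _ => ?_
  cases c <;> simp [Instr.core]

theorem mem_measured {P : OneWay V} {v : V} :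
    v ∈ P.measured ↔ ∃ θ, Instr.meas v θ ∅ ∈ P.instrs.filterMap Instr.core := by
  simp only [OneWay.measured, List.mem_toFinset, List.mem_filterMap]
  rw [exists_comm]
  refine exists_congr fun c => ?_
  cases c <;> simp [Instr.core]

omit [DecidableEq V] in
theorem mem_halfPi {P : OneWay V} {v : V} {θ : Real.Angle} :
    (∃ β, Instr.meas v θ β ∈ P.instrs) ↔
      Instr.meas v θ ∅ ∈ P.instrs.filterMap Instr.core := by
  simp only [List.mem_filterMap]
  constructor
  · rintro ⟨β, h⟩; exact ⟨_, h, rfl⟩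
  · rintro ⟨c, h, hc⟩
    cases c <;> simp [Instr.core] at hc
    obtain ⟨rfl, rfl⟩ := hc
    exact ⟨_, h⟩

omit [DecidableEq V] in
/-- Rules which preserve the core up to order can be applied anywhere in a procedure. -/
theorem Rewrite.core_perm {R : List (Instr V) → List (Instr V) → Prop}
    (hR : ∀ a b, R a b → (a.filterMap Instr.core).Perm (b.filterMap Instr.core))
    {a b : List (Instr V)} (h : Rewrite R a b) :
    (a.filterMap Instr.core).Perm (b.filterMap Instr.core) := by
  obtain ⟨l, r, a, b, h⟩ := h
  simp only [List.filterMap_append]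
  exact ((hR a b h).append_left _).append_right _

omit [DecidableEq V] in
theorem core_swap (c c' : Instr V) :
    ([c, c'].filterMap Instr.core).Perm ([c', c].filterMap Instr.core) :=
  (List.Perm.swap c' c []).filterMap _

/-- The rules reorder operations, or create, merge and absorb corrections and shifts, which the core
omits. Absorption alters control expressions only, never default angles. -/
theorem StdRule.core_perm (a b : List (Instr V)) (h : StdRule a b) :
    (a.filterMap Instr.core).Perm (b.filterMap Instr.core) := by
  cases h <;> exact core_swap _ _

omit [DecidableEq V] in
theorem PauliRule.core_perm (a b : List (Instr V)) (h : PauliRule a b) :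
    (a.filterMap Instr.core).Perm (b.filterMap Instr.core) := by
  cases h <;> simp [Instr.core]

theorem ShiftRule.core_perm (a b : List (Instr V)) (h : ShiftRule a b) :
    (a.filterMap Instr.core).Perm (b.filterMap Instr.core) := by
  cases h with
  | accum => exact .refl _
  | signal c => cases c <;> exact core_swap _ _

theorem ShiftStep.core_perm (a b : List (Instr V)) (h : ShiftStep a b) :
    (a.filterMap Instr.core).Perm (b.filterMap Instr.core) := by
  cases h with
  | rule _ _ h => exact h.core_perm ShiftRule.core_perm
  | drop => simp [List.filterMap_append, List.filterMap_cons, Instr.core]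

omit [DecidableEq V] in
theorem core_perm_of_reflTransGen {R : List (Instr V) → List (Instr V) → Prop}
    (hR : ∀ a b, R a b → (a.filterMap Instr.core).Perm (b.filterMap Instr.core))
    {a b : List (Instr V)} (h : Relation.ReflTransGen R a b) :
    (a.filterMap Instr.core).Perm (b.filterMap Instr.core) := by
  induction h with
  | refl => exact .refl _
  | tail _ h ih => exact ih.trans (hR _ _ h)

theorem Standardizes.core_perm {Q P : OneWay V} (h : Standardizes Q P) :
    (Q.instrs.filterMap Instr.core).Perm (P.instrs.filterMap Instr.core) :=
  core_perm_of_reflTransGen (fun _ _ h => h.core_perm StdRule.core_perm) h.2.1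

theorem Normalizes.core_perm {Q P : OneWay V} (h : Normalizes Q P) :
    (Q.instrs.filterMap Instr.core).Perm (P.instrs.filterMap Instr.core) := by
  obtain ⟨_, Q₁, h₁, L, h₂, _, h₃, _⟩ := h
  exact (h₁.core_perm.trans
    (core_perm_of_reflTransGen (fun _ _ h => h.core_perm PauliRule.core_perm) h₂)).trans
    (core_perm_of_reflTransGen ShiftStep.core_perm h₃)

theorem ArisesFrom.core_perm {Q P : OneWay Label} (h : ArisesFrom Q P) :
    (Q.instrs.filterMap Instr.core).Perm (P.instrs.filterMap Instr.core) := by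
  rcases h with rfl | h | h
  · exact .refl _
  · exact h.core_perm
  · exact h.core_perm

/-- A modified flow of the underlying geometry from a function on the labels and a monotone
description `done` of the sets of qubits which have been measured after a number of steps. -/
theorem exists_isModifiedFlow (P : OneWay V) (g : V → V) (done : ℕ → V → Prop)
    (hdone : ∀ k l v, k ≤ l → done k v → done l v)
    (hprep : ∀ v ∈ P.measured, g v ∈ P.prepared)
    (hinj : ∀ v ∈ P.measured, ∀ w ∈ P.measured, g v = g w → v = w)
    (hadj : ∀ v ∈ P.measured,
      (g v = v ∧ ∃ β, Instr.meas v ((Real.pi / 2 : ℝ) : Real.Angle) β ∈ P.instrs) ∨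
      (g v ≠ v ∧ Odd (P.entPairs.count s(g v, v)) ∧ ∃ k, done k v ∧ ¬ done k (g v)))
    (hnbr : ∀ v ∈ P.measured, ∀ w, w ≠ g v → s(w, g v) ∈ P.entPairs →
      v = w ∨ ∃ k, done k v ∧ ¬ done k w) :
    ∃ (f : {v : ↥P.qubits // v ∉ P.geomOutput} → {v : ↥P.qubits // v ∉ P.geomInput})
      (r : ↥P.qubits → ↥P.qubits → Prop),
      IsModifiedFlow P.graph P.geomInput P.geomOutput P.halfPiQubits f r := by
  have hm : ∀ v : {v : ↥P.qubits // v ∉ P.geomOutput}, (v : V) ∈ P.measured := by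
    intro v
    simpa [OneWay.geomOutput] using v.2
  refine ⟨fun v => ⟨⟨g v, Finset.mem_union_right _ (hprep _ (hm v))⟩, ?_⟩,
    -- The order of first completion. Since the sets `done k` increase, the stages `k` can be
    -- compared, which gives transitivity and antisymmetry.
    fun u v => (u : V) = v ∨ ∃ k, done k u ∧ ¬ done k v, ?_⟩
  · simpa [OneWay.geomInput] using hprep _ (hm v)
  have hadj' : ∀ v : {v : ↥P.qubits // v ∉ P.geomOutput}, g v ≠ v →
      P.graph.Adj ⟨g v, Finset.mem_union_right _ (hprep _ (hm v))⟩ v := by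
    intro v hv
    rcases hadj _ (hm v) with h | h
    · exact absurd h.1 hv
    · exact ⟨fun h' => hv (congrArg Subtype.val h'), h.2.1⟩
  constructor
  · intro v hv
    simp only [OneWay.halfPiQubits, Finset.mem_filter, Finset.mem_univ, true_and] at hv
    simp only [OneWay.geomOutput, Finset.mem_filter, Finset.mem_univ, true_and, not_not]
    exact mem_measured.2 ⟨_, mem_halfPi.1 hv⟩
  · intro v w h
    refine Subtype.ext (Subtype.ext (hinj _ (hm v) _ (hm w) ?_))
    exact congrArg (fun x => (x.1 : V)) h
  · refine @IsPartialOrder.mk _ _ (@IsPreorder.mk _ _ ⟨fun _ => .inl rfl⟩ ⟨?_⟩) ⟨?_⟩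
    · rintro a b c (hab | ⟨k, hk, hk'⟩) (hbc | ⟨l, hl, hl'⟩)
      · exact .inl (hab.trans hbc)
      · exact .inr ⟨l, hab ▸ hl, hl'⟩
      · exact .inr ⟨k, hk, hbc ▸ hk'⟩
      · have : k ≤ l := le_of_not_ge fun h => hk' (hdone _ _ _ h hl)
        exact .inr ⟨l, hdone _ _ _ this hk, hl'⟩
    · rintro a b (hab | ⟨k, hk, hk'⟩) (hba | ⟨l, hl, hl'⟩)
      · exact Subtype.ext hab
      · exact Subtype.ext hab
      · exact Subtype.ext hba.symm
      · rcases le_total k l with h | h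
        · exact absurd (hdone _ _ _ h hk) hl'
        · exact absurd (hdone _ _ _ h hl) hk'
  · intro v hv
    refine hadj' v fun h => ?_
    rcases hadj _ (hm v) with h' | h'
    · exact hv (by simpa [OneWay.halfPiQubits] using h'.2)
    · exact h'.1 h
  · intro v _
    by_cases h : g v = v
    · exact .inl (Subtype.ext h)
    · exact .inr (hadj' v h)
  · intro v
    rcases hadj _ (hm v) with h | h
    · exact .inl h.1.symm
    · exact .inr h.2.2
  · intro v w h
    refine hnbr _ (hm v) _ (fun h' => h.1 (Subtype.ext h')) ?_
    -- An edge of the graph is a pair of odd multiplicity, so it occurs at least once; only this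
    -- weaker fact is asked of neighbours.
    exact List.count_pos_iff.1 h.2.pos

end Core

/-! ### The flow of a translated circuit -/

section Translation

/-- The positions of the wires after the first `k` gates. -/
def positions (L : List JGate) (k : ℕ) : ℕ → ℕ := (L.take k).foldl JGate.advance 0

theorem advance_mono (d : ℕ → ℕ) (g : JGate) (v : ℕ) : d v ≤ g.advance d v := by
  cases g with
  | J θ w =>
    simp only [JGate.advance, Function.update_apply]
    split_ifs with h
    · subst h; omega
    · exact le_rfl
  | _ => exact le_rfl

theorem foldl_advance_mono (L : List JGate) (d : ℕ → ℕ) (v : ℕ) :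
    d v ≤ L.foldl JGate.advance d v := by
  induction L generalizing d with
  | nil => exact le_rfl
  | cons g L ih => exact (advance_mono d g v).trans (ih _)

theorem positions_mono (L : List JGate) (v : ℕ) {k l : ℕ} (h : k ≤ l) :
    positions L k v ≤ positions L l v := by
  unfold positions
  obtain ⟨m, rfl⟩ := Nat.exists_eq_add_of_le h
  rw [List.take_add, List.foldl_append]
  exact foldl_advance_mono _ _ _

theorem positions_succ (L : List JGate) {k : ℕ} {g : JGate} (h : L[k]? = some g) :
    positions L (k + 1) = g.advance (positions L k) := by
  unfold positions
  rw [List.take_add_one, List.foldl_append, h]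
  rfl

theorem getElem_stableIndex (L : List JGate) (d : ℕ → ℕ) (k : ℕ) :
    (stableIndex L d)[k]? = L[k]?.map fun g => g.term ((L.take k).foldl JGate.advance d) := by
  induction L generalizing d k with
  | nil => simp [stableIndex]
  | cons g L ih =>
    cases k with
    | zero => simp [stableIndex]
    | succ k => simp [stableIndex, ih]

theorem mem_translate {A : Finset ℕ} {L : List JGate} {c : Instr Label} :
    c ∈ (translate A (stableIndex L 0)).instrs ↔
      ∃ (k : ℕ) (g : JGate), L[k]? = some g ∧ c ∈ (g.term (positions L k)).instrs k := by
  simp only [translate, List.mem_flatMap, Prod.exists, List.mem_zipIdx_iff_getElem?,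
    getElem_stableIndex, Option.map_eq_some_iff]
  constructor
  · rintro ⟨_, k, ⟨g, hg, rfl⟩, hc⟩
    exact ⟨k, g, hg, hc⟩
  · rintro ⟨k, g, hg, hc⟩
    exact ⟨_, k, ⟨g, hg, rfl⟩, hc⟩

/-- The exact multiplicity is needed because repeated entangling maps cancel in the graph. Two
consecutive indices of a wire are never current together, so no `CZ` joins them; the pairs of a `Zz`
contain a mediating qubit; and only one `J` gate takes the wire from `j` to `j + 1`. The parameters
`d` and `n` are general for the sake of the induction. -/
theorem count_ent_stableIndex (L : List JGate) (d : ℕ → ℕ) (n v j : ℕ) :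
    ((((stableIndex L d).zipIdx n).flatMap fun t => t.1.instrs t.2).filterMap Instr.pair).count
      (s(Sum.inl (v, j + 1), Sum.inl (v, j)) : Sym2 Label) =
      if d v ≤ j ∧ j < L.foldl JGate.advance d v then 1 else 0 := by
  induction L generalizing d n with
  | nil =>
    rw [if_neg]
    · rfl
    · simp
  | cons g L ih =>
    have hmono := foldl_advance_mono L (g.advance d) v
    have hcons : ((((stableIndex (g :: L) d).zipIdx n).flatMap
        fun t => t.1.instrs t.2).filterMap Instr.pair) =
        ((g.term d).instrs n).filterMap Instr.pair ++
        ((((stableIndex L (g.advance d)).zipIdx (n + 1)).flatMap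
          fun t => t.1.instrs t.2).filterMap Instr.pair) := by
      simp [stableIndex]
    rw [hcons, List.count_append, ih, List.foldl_cons]
    cases g with
    | fresh a =>
      rw [show (JGate.fresh a).advance d = d from rfl]
      simp [JGate.term, StableTerm.instrs, List.filterMap_cons, Instr.pair]
    | CZ a b =>
      rw [show (JGate.CZ a b).advance d = d from rfl]
      have h : (s(Sum.inl (a, d a), Sum.inl (b, d b)) : Sym2 Label) ≠
          s(Sum.inl (v, j + 1), Sum.inl (v, j)) := by
        simp only [ne_eq, Sym2.eq_iff, Sum.inl.injEq, Prod.mk.injEq]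
        rintro (⟨⟨rfl, h⟩, rfl, h'⟩ | ⟨⟨rfl, h⟩, rfl, h'⟩) <;> omega
      simp [JGate.term, StableTerm.instrs, Instr.pair, h]
    | Zz a b =>
      rw [show (JGate.Zz a b).advance d = d from rfl]
      simp [JGate.term, StableTerm.instrs, List.filterMap_cons, Instr.pair]
    | J θ w =>
      have hadv : (JGate.J θ w).advance d v = if v = w then d w + 1 else d v := by
        simp [JGate.advance, Function.update_apply]
      generalize (JGate.J θ w).advance d = e at *
      simp only [JGate.term, StableTerm.instrs, List.filterMap_cons, Instr.pair,
        List.filterMap_nil, List.count_cons, List.count_nil]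
      by_cases hw : v = w
      · subst hw
        rw [if_pos rfl] at hadv
        by_cases hj : d v = j
        · subst hj
          -- This gate is the one counted. Afterwards the wire is beyond `j`, and the rest of the
          -- list contributes nothing.
          rw [if_pos (by simp [Sym2.eq_swap]), if_neg (by omega), if_pos (by omega)]
        · have h : (s(Sum.inl (v, d v), Sum.inl (v, d v + 1)) : Sym2 Label) ≠
              s(Sum.inl (v, j + 1), Sum.inl (v, j)) := by
            simp only [ne_eq, Sym2.eq_iff, Sum.inl.injEq, Prod.mk.injEq]
            omega
          rw [if_neg (by simpa using h), zero_add, zero_add]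
          have : (e v ≤ j ∧ j < L.foldl JGate.advance e v) ↔
              (d v ≤ j ∧ j < L.foldl JGate.advance e v) := by omega
          simp only [this]
      · have h : (s(Sum.inl (w, d w), Sum.inl (w, d w + 1)) : Sym2 Label) ≠
            s(Sum.inl (v, j + 1), Sum.inl (v, j)) := by
          simp [Ne.symm hw]
        rw [if_neg hw] at hadv
        rw [if_neg (by simpa using h), zero_add, zero_add]
        simp only [hadv]

theorem count_entPairs_translate (A : Finset ℕ) (L : List JGate) {k v : ℕ} {θ : Real.Angle}
    (h : L[k]? = some (.J θ v)) :
    (translate A (stableIndex L 0)).entPairs.count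
      (s(Sum.inl (v, positions L k v + 1), Sum.inl (v, positions L k v)) : Sym2 Label) = 1 := by
  have h1 := count_ent_stableIndex L 0 0 v (positions L k v)
  rw [if_pos] at h1
  · exact h1
  · refine ⟨Nat.zero_le _, ?_⟩
    have h2 := positions_succ L h
    have hk : k < L.length := (List.getElem?_eq_some_iff.1 h).1
    have h3 := positions_mono L v (Nat.succ_le_of_lt hk)
    have h4 : positions L L.length = L.foldl JGate.advance 0 := by
      simp [positions]
    rw [← h4]
    rw [Nat.succ_eq_add_one, h2] at h3
    simp only [JGate.advance, Function.update_self] at h3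
    omega

/-- The successor function: `J` gates advance the index, and mediating qubits are fixed. -/
def next : Label → Label
  | .inl (v, j) => .inl (v, j + 1)
  | .inr n => .inr n

/-- The qubits measured in the translation of the first `k` gates. -/
def doneAfter (L : List JGate) (k : ℕ) : Label → Prop
  | .inl (v, j) => j < positions L k v
  | .inr n => n < k

/-- For each neighbour of a successor, the entangling map that joins them supplies a stage
separating it from the measured qubit. The cases are the gates from which the map can come. -/
theorem translate_exists_isModifiedFlow (A : Finset ℕ) (L : List JGate) (P : OneWay Label)
    (h : ((translate A (stableIndex L 0)).instrs.filterMap Instr.core).Perm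
      (P.instrs.filterMap Instr.core)) :
    ∃ (f : {v : ↥P.qubits // v ∉ P.geomOutput} → {v : ↥P.qubits // v ∉ P.geomInput})
      (r : ↥P.qubits → ↥P.qubits → Prop),
      IsModifiedFlow P.graph P.geomInput P.geomOutput P.halfPiQubits f r := by
  have hcore : ∀ c, c ∈ P.instrs.filterMap Instr.core ↔
      ∃ (k : ℕ) (g : JGate), L[k]? = some g ∧
        ∃ c' ∈ (g.term (positions L k)).instrs k, c'.core = some c := by
    intro c
    rw [← h.mem_iff, List.mem_filterMap]
    constructor
    · rintro ⟨c', h', hc⟩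
      obtain ⟨k, g, hg, h''⟩ := mem_translate.1 h'
      exact ⟨k, g, hg, c', h'', hc⟩
    · rintro ⟨k, g, hg, c', h'', hc⟩
      exact ⟨c', mem_translate.2 ⟨k, g, hg, h''⟩, hc⟩
  have hmeas : ∀ u ∈ P.measured,
      (∃ k θ v, L[k]? = some (JGate.J θ v) ∧ u = .inl (v, positions L k v)) ∨
      (∃ k v w, L[k]? = some (JGate.Zz v w) ∧ u = .inr k) := by
    intro u hu
    obtain ⟨θ, hθ⟩ := mem_measured.1 hu
    obtain ⟨k, g, hg, c, hc, hcu⟩ := (hcore _).1 hθ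
    cases g with
    | fresh a => simp [JGate.term, StableTerm.instrs] at hc; subst hc; simp [Instr.core] at hcu
    | CZ a b => simp [JGate.term, StableTerm.instrs] at hc; subst hc; simp [Instr.core] at hcu
    | J θ' a =>
      simp only [JGate.term, StableTerm.instrs, List.mem_cons, List.not_mem_nil, or_false] at hc
      rcases hc with rfl | rfl | rfl | rfl <;> simp [Instr.core] at hcu
      exact .inl ⟨k, θ', a, hg, hcu.1.symm⟩
    | Zz a b =>
      simp only [JGate.term, StableTerm.instrs, List.mem_cons, List.not_mem_nil, or_false] at hc
      rcases hc with rfl | rfl | rfl | rfl | rfl | rfl <;> simp [Instr.core] at hcu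
      exact .inr ⟨k, a, b, hg, hcu.1.symm⟩
  have hent : P.entPairs.Perm (translate A (stableIndex L 0)).entPairs := by
    rw [entPairs_eq, entPairs_eq]
    exact h.symm.filterMap _
  have hpair : ∀ e ∈ P.entPairs, ∃ (k : ℕ) (g : JGate), L[k]? = some g ∧
      e ∈ ((g.term (positions L k)).instrs k).filterMap Instr.pair := by
    intro e he
    rw [hent.mem_iff] at he
    obtain ⟨c, hc, hce⟩ := List.mem_filterMap.1 he
    obtain ⟨k, g, hg, h'⟩ := mem_translate.1 hc
    refine ⟨k, g, hg, List.mem_filterMap.2 ⟨c, h', ?_⟩⟩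
    rw [← hce]
    cases c <;> rfl
  refine exists_isModifiedFlow P next (doneAfter L) ?_ ?_ ?_ ?_ ?_
  · rintro k l (⟨v, j⟩ | n) hkl
    · exact fun h' => lt_of_lt_of_le h' (positions_mono L v hkl)
    · exact fun h' => lt_of_lt_of_le h' hkl
  · intro u hu
    rw [mem_prepared, hcore]
    rcases hmeas u hu with ⟨k, θ, v, hk, rfl⟩ | ⟨k, v, w, hk, rfl⟩
    · exact ⟨k, _, hk, .prep (.inl (v, positions L k v + 1)),
        by simp [JGate.term, StableTerm.instrs], rfl⟩
    · exact ⟨k, _, hk, .prep (.inr k), by simp [JGate.term, StableTerm.instrs], rfl⟩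
  · rintro (⟨v, j⟩ | n) _ (⟨w, l⟩ | m) _ h' <;> simp_all [next]
  · intro u hu
    rcases hmeas u hu with ⟨k, θ, v, hk, rfl⟩ | ⟨k, v, w, hk, rfl⟩
    · refine .inr ⟨by simp [next], ?_, k + 1, ?_, ?_⟩
      · rw [hent.count_eq, next, count_entPairs_translate A L hk]
        exact odd_one
      · simp [doneAfter, positions_succ L hk, JGate.advance]
      · simp [next, doneAfter, positions_succ L hk, JGate.advance]
    · exact .inl ⟨rfl, mem_halfPi.2 ((hcore _).2 ⟨k, _, hk,
        .meas (.inr k) ((Real.pi / 2 : ℝ) : Real.Angle) ∅,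
        by simp [JGate.term, StableTerm.instrs], rfl⟩)⟩
  · intro u hu w hw he
    obtain ⟨l, g, hg, he⟩ := hpair _ he
    rcases hmeas u hu with ⟨k, θ, v, hk, rfl⟩ | ⟨k, v, v', hk, rfl⟩
    · have hpos := positions_succ L hk
      cases g with
      | fresh a => simp [JGate.term, StableTerm.instrs, List.filterMap_cons, Instr.pair] at he
      | CZ a b =>
        simp only [JGate.term, StableTerm.instrs, List.filterMap_cons, Instr.pair, next,
          List.filterMap_nil, List.mem_singleton, Sym2.eq_iff, Sum.inl.injEq, Prod.mk.injEq] at he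
        right
        -- When the gate acts, the successor of `u` is the current index of its wire, so `u` has
        -- been measured, while `w` is current on the other wire.
        refine ⟨l, ?_, ?_⟩ <;> rcases he with ⟨rfl, rfl, h'⟩ | ⟨rfl, rfl, h'⟩ <;>
          simp [doneAfter] <;> omega
      | Zz a b =>
        simp [JGate.term, StableTerm.instrs, List.filterMap_cons, Instr.pair, next] at he
        right
        -- Here `w` is the mediating qubit of the gate `l`, not yet measured after the first `l`
        -- gates.
        refine ⟨l, ?_, ?_⟩ <;> rcases he with ⟨rfl, rfl, h'⟩ | ⟨rfl, rfl, h'⟩ <;>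
          simp [doneAfter] <;> omega
      | J θ' a =>
        simp only [JGate.term, StableTerm.instrs, List.filterMap_cons, Instr.pair, next,
          List.filterMap_nil, List.mem_singleton, Sym2.eq_iff, Sum.inl.injEq, Prod.mk.injEq] at he
        -- Either the gate is the one that measures `u`, and `w` is `u` itself, or it is the next
        -- `J` on the wire, and `w` lies two positions beyond `u`.
        rcases he with ⟨rfl, rfl, h'⟩ | ⟨rfl, rfl, h'⟩
        · left
          rw [Nat.add_right_cancel h']
        · right
          refine ⟨k + 1, ?_, ?_⟩ <;> simp [doneAfter, hpos, JGate.advance] <;> omega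
    · cases g with
      | fresh a => simp [JGate.term, StableTerm.instrs, List.filterMap_cons, Instr.pair] at he
      | CZ a b =>
        simp [JGate.term, StableTerm.instrs, Instr.pair, next] at he
      | J θ' a =>
        simp [JGate.term, StableTerm.instrs, List.filterMap_cons, Instr.pair, next] at he
      | Zz a b =>
        have hpos := positions_succ L hg
        simp [JGate.term, StableTerm.instrs, List.filterMap_cons, Instr.pair, next] at he
        right
        -- The mediating qubit is measured during the gate `l` itself, which leaves both wires at
        -- their current, unmeasured indices.
        refine ⟨l + 1, ?_, ?_⟩ <;> rcases he with ⟨rfl, rfl⟩ | ⟨rfl, rfl⟩ <;>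
          simp [doneAfter, hpos, JGate.advance]

end Translation

end MBQC

open MBQC
theorem mainTheorem2 :
    (∀ (V : Type*) [Fintype V] [LinearOrder V] (G : SimpleGraph V) (I O M : Finset V)
      (f : {v : V // v ∉ O} → {v : V // v ∉ I}) (r : V → V → Prop)
      (θ : {v : V // v ∉ O} → Real.Angle),
      IsModifiedFlow G I O M f r →
      (∀ u v : V, r u v → u ≤ v) →
      (∀ u : {v : V // v ∉ O}, (u : V) ∈ M → θ u = ((Real.pi / 2 : ℝ) : Real.Angle)) →
      (flowProcedure G I O f θ).output = O ∧ (flowProcedure G I O f θ).PerformsUnitary) ∧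
    (∀ P : OneWay Label, ArisesFromDKP P ∨ ArisesFromRBB P →
      ∃ (f : {v : ↥P.qubits // v ∉ P.geomOutput} → {v : ↥P.qubits // v ∉ P.geomInput})
        (r : ↥P.qubits → ↥P.qubits → Prop),
        IsModifiedFlow P.graph P.geomInput P.geomOutput P.halfPiQubits f r) := by
  refine ⟨fun V _ _ G I O M f r θ hf hr hθ => ?_, fun P hP => ?_⟩
  · have h := hf.flowProcedure_wellFormed (θ := θ) hr
    exact ⟨h.2, performsUnitary_of_phases h.1 flowProcedure_noShift
      (hf.linAll_flowProcedure hr hθ)⟩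
  · rcases hP with ⟨C, _, h⟩ | ⟨C, _, _, h⟩
    · exact translate_exists_isModifiedFlow _ _ P h.core_perm
    · exact translate_exists_isModifiedFlow _ _ P h.core_perm
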